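/- Let $(\Omega,\mathcal F,\mathbb P)$ be a probability space with a filtration $(\mathcal F^W_t)_{t\ge 0}$, let $\sigma>0$, $S_0>0$, $\beta_0\in\mathbb R$, $\nu_0^2>0$, and let $\mu$ be a random variable with law $\mathcal N(\beta_0,\nu_0^2)$. Let $W$ be a standard Wiener process that is independent of $\mu$, and assume that $W$ is a Wiener process relative to the filtration $\mathcal G_t=\mathcal F^W_t\vee\sigma(\mu)$, i.e. it is adapted to it and $W_t-W_s$ is independent of $\mathcal G_s$ for $s\le t$ (this is automatic when $(\mathcal F^W_t)$ is the, possibly augmented, filtration generated by $W$). Let $S$ be a continuous, $(\mathcal G_t)$-adapted solution of the stochastic differential equation $$dS_t=\mu S_t\,dt+\sigma S_t\,dW_t$$ with deterministic initial value $S_0$, and let $\mathcal F^S_t=\sigma(S_s:0\le s\le t)$. Then, for every $t\ge 0$, given $\mathcal F^S_t$ the random variable $\mu$ is conditionally normally distributed with mean $\beta_t$ and variance $\nu_t^2$, where, almost surely, $$\beta_t=\frac{\sigma^2}{\sigma^2+\nu_0^2t}\,\beta_0+\frac{\nu_0^2}{\sigma^2+\nu_0^2t}\,(\mu t+\sigma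 W_t)=\frac{\sigma^2}{\sigma^2+\nu_0^2t}\,\beta_0+\frac{\nu_0^2}{\sigma^2+\nu_0^2t}\left(\log\frac{S_t}{S_0}+\frac12\sigma^2t\right)$$ and $$\nu_t^2=\frac{\sigma^2\nu_0^2}{\sigma^2+\nu_0^2t}.$$ That is, $\mathbb P(\mu\in B\mid\mathcal F^S_t)=\mathcal N(\beta_t,\nu_t^2)(B)$ almost surely for every Borel set $B\subseteq\mathbb R$; and the last expression for $\beta_t$ is $\mathcal F^S_t$-measurable. -/

import Mathlib

open MeasureTheory ProbabilityTheory Filter Topology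
open scoped NNReal

noncomputable section

/-- The smallest filtration containing `𝓕` for which `μ` is known from time `0` on:
at time `t` it is the σ-algebra generated by `𝓕 t` and `μ`. -/
def initialEnlargement {Ω : Type*} {mΩ : MeasurableSpace Ω} (𝓕 : Filtration ℝ≥0 mΩ)
    (μ : Ω → ℝ) (hμ : Measurable μ) : Filtration ℝ≥0 mΩ :=
  𝓕 ⊔ Filtration.const ℝ≥0 (MeasurableSpace.comap μ inferInstance) hμ.comap_le

/-- `W` is a standard Wiener process relative to the filtration `𝓖`: a standard Brownian motion,
adapted to `𝓖`, whose increments after time `s` are independent of `𝓖 s`. -/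
structure IsWienerProcess {Ω : Type*} {mΩ : MeasurableSpace Ω} (𝓖 : Filtration ℝ≥0 mΩ)
    (W : ℝ≥0 → Ω → ℝ) (P : Measure Ω) : Prop extends IsBrownianReal W P where
  adapted : ∀ t, Measurable[𝓖 t] (W t)
  indep_increment : ∀ s t, s ≤ t →
    Indep (MeasurableSpace.comap (fun ω ↦ W t ω - W s ω) inferInstance) (𝓖 s) P

/-- A subdivision `0 = point 0 ≤ point 1 ≤ ⋯ ≤ point size = t` of the interval `[0, t]`
(the values of `point` beyond `size` play no role). -/
structure TimeSubdivision (t : ℝ≥0) where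
  size : ℕ
  point : ℕ → ℝ≥0
  mono : Monotone point
  point_zero : point 0 = 0
  point_size : point size = t

/-- The length of the longest interval of a subdivision. -/
def TimeSubdivision.mesh {t : ℝ≥0} (π : TimeSubdivision t) : ℝ≥0 :=
  (Finset.range π.size).sup fun i ↦ π.point (i + 1) - π.point i

/-- The left-endpoint sum `∑ i, H (tᵢ) * (W (tᵢ₊₁) - W (tᵢ))` along a subdivision. -/
def itoSum {Ω : Type*} (H W : ℝ≥0 → Ω → ℝ) {t : ℝ≥0} (π : TimeSubdivision t) (ω : Ω) : ℝ :=
  ∑ i ∈ Finset.range π.size,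
    H (π.point i) ω * (W (π.point (i + 1)) ω - W (π.point i) ω)

/-- `I` is (a version of) the Itô integral `∫₀ᵗ H dW` of an adapted process `H` with continuous
paths: the limit in probability of the left-endpoint sums, along every sequence of subdivisions of
`[0, t]` whose mesh tends to `0`. -/
def HasItoIntegral {Ω : Type*} {mΩ : MeasurableSpace Ω} (H W : ℝ≥0 → Ω → ℝ) (P : Measure Ω)
    (t : ℝ≥0) (I : Ω → ℝ) : Prop :=
  ∀ π : ℕ → TimeSubdivision t, Tendsto (fun k ↦ (π k).mesh) atTop (𝓝 0) →
    TendstoInMeasure P (fun k ↦ itoSum H W (π k)) atTop I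

/-- `S` is a solution, on the space filtered by `𝓖`, of the stochastic differential equation
`dS = μ S dt + σ S dW` with `S₀ = s₀`: it is `𝓖`-adapted, has continuous paths, and for every `t`,
almost surely, `S t = S 0 + ∫₀ᵗ μ S u du + ∫₀ᵗ σ S u dW u`. The drift `μ` may be random. -/
structure IsLogNormalPrice {Ω : Type*} {mΩ : MeasurableSpace Ω} (𝓖 : Filtration ℝ≥0 mΩ)
    (W : ℝ≥0 → Ω → ℝ) (P : Measure Ω) (μ : Ω → ℝ) (σ s₀ : ℝ) (S : ℝ≥0 → Ω → ℝ) : Prop where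
  adapted : ∀ t, Measurable[𝓖 t] (S t)
  continuous : ∀ᵐ ω ∂P, Continuous fun t ↦ S t ω
  initial : ∀ᵐ ω ∂P, S 0 ω = s₀
  sde : ∀ t : ℝ≥0, ∃ I : Ω → ℝ, HasItoIntegral (fun u ω ↦ σ * S u ω) W P t I ∧
    ∀ᵐ ω ∂P, S t ω = S 0 ω + (∫ u in (0 : ℝ)..t, μ ω * S u.toNNReal ω) + I ω

theorem IsLogNormalPrice.stronglyMeasurable {Ω : Type*} {mΩ : MeasurableSpace Ω}
    {𝓖 : Filtration ℝ≥0 mΩ} {W : ℝ≥0 → Ω → ℝ} {P : Measure Ω} {μ : Ω → ℝ} {σ s₀ : ℝ}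
    {S : ℝ≥0 → Ω → ℝ} (hS : IsLogNormalPrice 𝓖 W P μ σ s₀ S) (t : ℝ≥0) :
    StronglyMeasurable (S t) :=
  ((hS.adapted t).mono (𝓖.le t) le_rfl).stronglyMeasurable

/-- Given the σ-algebra `m`, the real random variable `X` is conditionally normally distributed
with (random) mean `b` and variance `v`: the measures `N(b ω, v)` are a version of the conditional
distribution of `X` given `m`, that is, `P(X ∈ B | m) = N(b, v)(B)` almost surely for each Borel
set `B`. -/
def IsCondNormal {Ω : Type*} (m : MeasurableSpace Ω) {mΩ : MeasurableSpace Ω} (P : Measure Ω)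
    (X : Ω → ℝ) (b : Ω → ℝ) (v : ℝ≥0) : Prop :=
  ∀ B : Set ℝ, MeasurableSet B → P⟦X ⁻¹' B | m⟧ =ᵐ[P] fun ω ↦ (gaussianReal (b ω) v).real B

/-- The posterior mean as a function of the observation `y` made at time `t`. -/
def posteriorMean (σ β₀ ν₀ : ℝ) (t : ℝ≥0) (y : ℝ) : ℝ :=
  σ ^ 2 / (σ ^ 2 + ν₀ ^ 2 * t) * β₀ + ν₀ ^ 2 / (σ ^ 2 + ν₀ ^ 2 * t) * y

/-- The posterior variance at time `t`. -/
def posteriorVariance (σ ν₀ : ℝ) (t : ℝ≥0) : ℝ :=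
  σ ^ 2 * ν₀ ^ 2 / (σ ^ 2 + ν₀ ^ 2 * t)

end

/-! The equation is first solved: almost surely `S t = s₀ * exp ((μ - σ² / 2) t + σ W t)`
(`IsLogNormalPrice.ae_eq_exp`). Observing `S` up to time `t` then amounts to observing the Gaussian
process `s μ + σ W s`, `s ≤ t`. With `q = σ² + ν₀² t`, the residual `D = μ - (ν₀² / q) (μ t + σ W
t)` is uncorrelated with each of these variables, hence independent of all of them by joint
Gaussianity (`indepFun_linear_drift`). So `μ` is an independent normal variable plus an observable
one, and its conditional law is the law of `D` shifted by the observable part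
(`isCondNormal_add_of_indep`).

Solving the equation uses only the Itô integral as a limit in probability of left-endpoint sums. Let
`y` be the inverse of the exponential solution with initial value 1. The increments of `S y`
telescope along a coarse grid. An Euler step contributes `-(σ² / 2) S y ((Δw)² - Δ)` up to a
uniformly negligible multiple of `(Δw)² + Δ` (`abs_euler_mul_exp_le`). The Euler error is a sum over
a finer grid of small adapted factors times increments of `W`, plus errors of the left-endpoint sums
(`eulerError_eq`); a diagonal choice of the fine grid makes the latter small at all coarse points
simultaneously.

All other remainders are sums of adapted factors times centered noise, controlled by orthogonality
in `L²` after truncating the factors (`tendstoInMeasure_sum_sq_blocks`). Along a subsequence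
everything tends to `0` almost surely, and `mul_discount_eq` concludes path by path that `S t * y t
= S 0 * y 0`. -/

/-! ### Orthogonal noise and convergence in probability. -/

/-- Square integrable centered variables `ξ k` of variance at most `v`, each measurable with respect
to the next σ-algebra of `ℱ` and independent of the present one. -/
structure IsCenteredNoise {Ω : Type*} {mΩ : MeasurableSpace Ω} (P : Measure Ω)
    (ℱ : ℕ → MeasurableSpace Ω) (ξ : ℕ → Ω → ℝ) (v : ℝ) : Prop where
  mono : Monotone ℱ
  le : ∀ k, ℱ k ≤ mΩ
  measurable : ∀ k, Measurable[ℱ (k + 1)] (ξ k)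
  memLp : ∀ k, MemLp (ξ k) 2 P
  integral_eq_zero : ∀ k, ∫ ω, ξ k ω ∂P = 0
  integral_sq_le : ∀ k, ∫ ω, ξ k ω ^ 2 ∂P ≤ v
  indep : ∀ k, Indep (MeasurableSpace.comap (ξ k) inferInstance) (ℱ k) P

theorem IsCenteredNoise.shift {Ω : Type*} {mΩ : MeasurableSpace Ω} {P : Measure Ω}
    {ℱ : ℕ → MeasurableSpace Ω} {ξ : ℕ → Ω → ℝ} {v : ℝ} (h : IsCenteredNoise P ℱ ξ v) (a : ℕ) :
    IsCenteredNoise P (fun k ↦ ℱ (a + k)) (fun k ↦ ξ (a + k)) v where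
  mono := fun _ _ hij ↦ h.mono (by lia)
  le k := h.le _
  measurable k := h.measurable _
  memLp k := h.memLp _
  integral_eq_zero k := h.integral_eq_zero _
  integral_sq_le k := h.integral_sq_le _
  indep k := h.indep _

/-- Orthogonality of martingale differences: the partial sum times the next factor is measurable for
the present σ-algebra, hence independent of the next centered noise, so the cross term has mean zero
and second moments add. -/
theorem IsCenteredNoise.integral_sq_sum_le {Ω : Type*} {mΩ : MeasurableSpace Ω} {P : Measure Ω}
    [IsProbabilityMeasure P]
    {ℱ : ℕ → MeasurableSpace Ω} {ξ : ℕ → Ω → ℝ} {v : ℝ} (h : IsCenteredNoise P ℱ ξ v)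
    {G : ℕ → Ω → ℝ} {δ : ℝ} (hGm : ∀ k, Measurable[ℱ k] (G k))
    (hG : ∀ k ω, |G k ω| ≤ δ) (N : ℕ) :
    Measurable[ℱ N] (fun ω ↦ ∑ k ∈ Finset.range N, G k ω * ξ k ω) ∧
    MemLp (fun ω ↦ ∑ k ∈ Finset.range N, G k ω * ξ k ω) 2 P ∧
    ∫ ω, (∑ k ∈ Finset.range N, G k ω * ξ k ω) ^ 2 ∂P ≤ δ ^ 2 * (N * v) := by
  induction N with
  | zero => simp
  | succ N ih =>
    obtain ⟨ihm, ihL, ihI⟩ := ih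
    set A : Ω → ℝ := fun ω ↦ ∑ k ∈ Finset.range N, G k ω * ξ k ω with hA
    have hGm' := (hGm N).mono (h.le N) le_rfl
    have hAm' := ihm.mono (h.le N) le_rfl
    have hξm' := (h.measurable N).mono (h.le _) le_rfl
    have hGb : MemLp (G N) ⊤ P := memLp_top_of_bound hGm'.aestronglyMeasurable δ
      (ae_of_all _ fun ω ↦ hG N ω)
    have hGξ : MemLp (fun ω ↦ G N ω * ξ N ω) 2 P := (h.memLp N).mul hGb
    have hAG : MemLp (fun ω ↦ A ω * G N ω) 2 P := hGb.mul ihL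
    have ind {f : Ω → ℝ} (hf : Measurable[ℱ N] f) : IndepFun f (ξ N) P := by
      rw [IndepFun_iff_Indep]
      exact (indep_of_indep_of_le_right (h.indep N) hf.comap_le).symm
    have e1 : ∫ ω, (A ω * G N ω) * ξ N ω ∂P = 0 := by
      have := (ind (ihm.mul (hGm N))).integral_fun_mul_eq_mul_integral
        (hAm'.mul hGm').aestronglyMeasurable hξm'.aestronglyMeasurable
      simpa [h.integral_eq_zero] using this
    have e2 : ∫ ω, (G N ω * ξ N ω) ^ 2 ∂P ≤ δ ^ 2 * v := by
      calc ∫ ω, (G N ω * ξ N ω) ^ 2 ∂P ≤ ∫ ω, δ ^ 2 * ξ N ω ^ 2 ∂P := by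
            refine integral_mono hGξ.integrable_sq ((h.memLp N).integrable_sq.const_mul _)
              fun ω ↦ ?_
            simp only [mul_pow]
            gcongr ?_ * _
            exact sq_le_sq' (by linarith [neg_abs_le (G N ω), hG N ω])
              ((le_abs_self _).trans (hG N ω))
        _ = δ ^ 2 * ∫ ω, ξ N ω ^ 2 ∂P := integral_const_mul _ _
        _ ≤ δ ^ 2 * v := by gcongr; exact h.integral_sq_le N
    have hsum : (fun ω ↦ ∑ k ∈ Finset.range (N + 1), G k ω * ξ k ω) =
        fun ω ↦ A ω + G N ω * ξ N ω := by
      ext ω; simp [hA, Finset.sum_range_succ]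
    refine ⟨?_, ?_, ?_⟩
    · rw [hsum]
      exact (ihm.mono (h.mono N.le_succ) le_rfl).add
        (((hGm N).mono (h.mono N.le_succ) le_rfl).mul (h.measurable N))
    · rw [hsum]; exact ihL.add hGξ
    · have hexp : ∀ ω, (∑ k ∈ Finset.range (N + 1), G k ω * ξ k ω) ^ 2 =
          A ω ^ 2 + 2 * ((A ω * G N ω) * ξ N ω) + (G N ω * ξ N ω) ^ 2 := fun ω ↦ by
        rw [Finset.sum_range_succ]; simp only [hA]; ring
      have i2 : Integrable (fun ω ↦ 2 * ((A ω * G N ω) * ξ N ω)) P :=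
        (MemLp.integrable_mul hAG (h.memLp N)).const_mul 2
      simp_rw [hexp]
      have i1 : Integrable (fun ω ↦ A ω ^ 2 + 2 * ((A ω * G N ω) * ξ N ω)) P :=
        ihL.integrable_sq.add i2
      rw [integral_add i1 hGξ.integrable_sq,
        integral_add ihL.integrable_sq i2, integral_const_mul, e1]
      push_cast
      linarith

/-- A localization principle: `X - Y` vanishes eventually on almost every path, hence tends to `0`
in probability, while Markov's inequality controls `Y`. The approximation `Y` may depend on the
target `η`. -/
theorem tendstoInMeasure_zero_of_approx {Ω : Type*} {mΩ : MeasurableSpace Ω} {P : Measure Ω}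
    [IsProbabilityMeasure P] {X : ℕ → Ω → ℝ} (hX : ∀ n, AEStronglyMeasurable (X n) P)
    (h : ∀ η > 0, ∃ Y : ℕ → Ω → ℝ, (∀ᵐ ω ∂P, ∀ᶠ n in atTop, X n ω = Y n ω) ∧
      (∀ n, Integrable (Y n) P) ∧ (∀ n ω, 0 ≤ Y n ω) ∧ ∀ᶠ n in atTop, ∫ ω, Y n ω ∂P ≤ η) :
    TendstoInMeasure P X atTop 0 := by
  rw [tendstoInMeasure_iff_measureReal_norm]
  intro ε hε
  rw [Metric.tendsto_atTop']
  simp only [Pi.zero_apply, sub_zero, Real.norm_eq_abs, dist_zero_right, abs_of_nonneg measureReal_nonneg]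
  intro κ hκ
  -- Markov's inequality at level `ε / 2` turns this bound into probability at most `κ / 2`.
  obtain ⟨Y, hXY, hYi, hY0, hYη⟩ := h (ε / 2 * (κ / 2)) (by positivity)
  have hd : TendstoInMeasure P (fun n ω ↦ X n ω - Y n ω) atTop 0 := by
    refine tendstoInMeasure_of_tendsto_ae (fun n ↦ (hX n).sub (hYi n).1) ?_
    filter_upwards [hXY] with ω hω
    exact tendsto_const_nhds.congr' (by filter_upwards [hω] with n hn; simp [hn])
  rw [tendstoInMeasure_iff_measureReal_norm] at hd
  have hd' := (hd (ε / 2) (by positivity)).eventually_lt_const (u := κ / 2) (by positivity)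
  obtain ⟨n₀, hn₀⟩ := eventually_atTop.1 (hd'.and hYη)
  refine ⟨n₀, fun n hn ↦ ?_⟩
  obtain ⟨h1, h2⟩ := hn₀ n hn.le
  have h3 : P.real {ω | ε / 2 ≤ Y n ω} ≤ κ / 2 := by
    have := (mul_meas_ge_le_integral_of_nonneg (ae_of_all _ (hY0 n)) (hYi n) (ε / 2)).trans h2
    exact le_of_mul_le_mul_left this (by positivity)
  calc P.real {ω | ε ≤ |X n ω|}
      ≤ P.real ({ω | ε / 2 ≤ ‖X n ω - Y n ω - (0 : Ω → ℝ) ω‖} ∪ {ω | ε / 2 ≤ Y n ω}) := by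
        refine measureReal_mono fun ω hω ↦ ?_
        simp only [Set.mem_ofPred_eq, Set.mem_union, Pi.zero_apply, sub_zero, Real.norm_eq_abs]
          at hω ⊢
        by_contra! hc
        have := abs_add_le (X n ω - Y n ω) (Y n ω)
        rw [abs_of_nonneg (hY0 n ω)] at this
        simp only [sub_add_cancel] at this
        linarith
    _ ≤ _ := measureReal_union_le _ _
    _ < κ := by linarith

theorem TendstoInMeasure.add_zero_zero {Ω : Type*} {mΩ : MeasurableSpace Ω} {P : Measure Ω}
    [IsProbabilityMeasure P] {X Y : ℕ → Ω → ℝ} (hX : TendstoInMeasure P X atTop 0)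
    (hY : TendstoInMeasure P Y atTop 0) :
    TendstoInMeasure P (fun n ω ↦ X n ω + Y n ω) atTop 0 := by
  rw [tendstoInMeasure_iff_measureReal_norm] at hX hY ⊢
  intro ε hε
  have := (hX (ε / 2) (by positivity)).add (hY (ε / 2) (by positivity))
  rw [add_zero] at this
  refine squeeze_zero (fun _ ↦ measureReal_nonneg) (fun n ↦ ?_) this
  refine (measureReal_mono fun ω hω ↦ ?_).trans (measureReal_union_le _ _)
  simp only [Set.mem_ofPred_eq, Set.mem_union, Pi.zero_apply, sub_zero, Real.norm_eq_abs] at hω ⊢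
  by_contra! hc
  linarith [abs_add_le (X n ω) (Y n ω)]

theorem TendstoInMeasure.sum_zero {Ω ι : Type*} {mΩ : MeasurableSpace Ω} {P : Measure Ω}
    [IsProbabilityMeasure P] {X : ι → ℕ → Ω → ℝ} (s : Finset ι)
    (hX : ∀ i ∈ s, TendstoInMeasure P (X i) atTop 0) :
    TendstoInMeasure P (fun n ω ↦ ∑ i ∈ s, X i n ω) atTop 0 := by
  classical
  induction s using Finset.induction_on with
  | empty =>
    rw [tendstoInMeasure_iff_measureReal_norm]
    intro ε hε
    simp [not_le.2 hε]
  | insert a s ha ih =>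
    simp_rw [Finset.sum_insert ha]
    exact TendstoInMeasure.add_zero_zero (hX a (by simp)) (ih fun i hi ↦ hX i (by simp [hi]))

/-- The sums of squares of the block sums of `G * ξ` tend to `0` in probability, as soon as the
factors `G` are dominated by constants `δ` that are small compared to the total variance. -/
theorem tendstoInMeasure_sum_sq_blocks {Ω : Type*} {mΩ : MeasurableSpace Ω} {P : Measure Ω}
    [IsProbabilityMeasure P] {ℱ : ℕ → ℕ → MeasurableSpace Ω} {ξ : ℕ → ℕ → Ω → ℝ} {v : ℕ → ℝ}
    (h : ∀ n, IsCenteredNoise P (ℱ n) (ξ n) (v n)) {G : ℕ → ℕ → Ω → ℝ}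
    (hGm : ∀ n k, Measurable[ℱ n k] (G n k)) (a m : ℕ → ℕ)
    (hδ : ∀ η > 0, ∃ δ : ℕ → ℝ, (∀ n, 0 ≤ δ n) ∧
      (∀ᵐ ω ∂P, ∀ᶠ n in atTop, ∀ k < a n * m n, |G n k ω| ≤ δ n) ∧
      ∀ᶠ n in atTop, δ n ^ 2 * (a n * m n * v n) ≤ η) :
    TendstoInMeasure P (fun n ω ↦ ∑ i ∈ Finset.range (a n),
      (∑ l ∈ Finset.range (m n), G n (i * m n + l) ω * ξ n (i * m n + l) ω) ^ 2) atTop 0 := by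
  have hGm' n k : Measurable (G n k) := (hGm n k).mono ((h n).le k) le_rfl
  have hξm' n k : Measurable (ξ n k) := ((h n).measurable k).mono ((h n).le _) le_rfl
  refine tendstoInMeasure_zero_of_approx (fun n ↦ Measurable.aestronglyMeasurable (by fun_prop)) ?_
  intro η hη
  obtain ⟨δ, hδ0, hGδ, hδη⟩ := hδ η hη
  -- Truncating at `±δ n` keeps the factors adapted and gives the deterministic bound needed in
  -- `L²`; on almost every path it eventually changes nothing.
  let T n k ω : ℝ := max (-δ n) (min (δ n) (G n k ω))
  have hTb n k ω : |T n k ω| ≤ δ n := by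
    have := hδ0 n
    rw [abs_le]
    exact ⟨le_max_left _ _, max_le (by linarith) (min_le_left _ _)⟩
  have hTm n k : Measurable[ℱ n k] (T n k) := measurable_const.max (measurable_const.min (hGm n k))
  have key n i := ((h n).shift (i * m n)).integral_sq_sum_le (G := fun k ↦ T n (i * m n + k))
    (δ := δ n) (fun k ↦ hTm n _) (fun k ω ↦ hTb n _ ω) (m n)
  refine ⟨fun n ω ↦ ∑ i ∈ Finset.range (a n),
      (∑ l ∈ Finset.range (m n), T n (i * m n + l) ω * ξ n (i * m n + l) ω) ^ 2, ?_, ?_, ?_, ?_⟩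
  · filter_upwards [hGδ] with ω hω
    filter_upwards [hω] with n hn
    refine Finset.sum_congr rfl fun i hi ↦ ?_
    congr 1
    refine Finset.sum_congr rfl fun l hl ↦ ?_
    congr 1
    rw [Finset.mem_range] at hi hl
    have hlt : i * m n + l < a n * m n := by
      calc i * m n + l < i * m n + m n := by lia
        _ = (i + 1) * m n := by ring
        _ ≤ a n * m n := Nat.mul_le_mul_right _ hi
    have := abs_le.1 (hn _ hlt)
    simp only [T]
    rw [min_eq_right this.2, max_eq_right this.1]
  · exact fun n ↦ integrable_finsetSum _ fun i _ ↦ (key n i).2.1.integrable_sq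
  · exact fun n ω ↦ Finset.sum_nonneg fun i _ ↦ sq_nonneg _
  · filter_upwards [hδη] with n hn
    rw [integral_finsetSum _ fun i _ ↦ (key n i).2.1.integrable_sq]
    refine (Finset.sum_le_sum fun i _ ↦ (key n i).2.2).trans ?_
    rw [Finset.sum_const, Finset.card_range, nsmul_eq_mul]
    linarith

/-! ### Uniform grids and continuous paths. -/

/-- The points of the uniform subdivision of `[0, t]` into `N` intervals. -/
noncomputable def gridPoint (t : ℝ≥0) (N i : ℕ) : ℝ≥0 := t * i / N

theorem gridPoint_mono (t : ℝ≥0) (N : ℕ) : Monotone (gridPoint t N) := fun i j h ↦ by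
  unfold gridPoint; gcongr

@[simp] theorem gridPoint_zero (t : ℝ≥0) (N : ℕ) : gridPoint t N 0 = 0 := by simp [gridPoint]

theorem gridPoint_self (t : ℝ≥0) {N : ℕ} (hN : N ≠ 0) : gridPoint t N N = t := by
  unfold gridPoint; field_simp

theorem gridPoint_le (t : ℝ≥0) {N i : ℕ} (hi : i ≤ N) : gridPoint t N i ≤ t := by
  rcases eq_or_ne N 0 with rfl | hN
  · simp [gridPoint]
  · exact (gridPoint_mono t N hi).trans_eq (gridPoint_self t hN)

theorem gridPoint_mul (t : ℝ≥0) (N i : ℕ) {M : ℕ} (hM : M ≠ 0) :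
    gridPoint t (N * M) (i * M) = gridPoint t N i := by
  rcases eq_or_ne N 0 with rfl | hN
  · simp [gridPoint]
  · unfold gridPoint; push_cast; field_simp

theorem gridPoint_succ (t : ℝ≥0) (N i : ℕ) :
    (gridPoint t N (i + 1) : ℝ) = gridPoint t N i + t / N := by
  simp only [gridPoint]; push_cast; ring

theorem gridPoint_succ_nnreal (t : ℝ≥0) (N i : ℕ) :
    gridPoint t N (i + 1) = gridPoint t N i + t / N := by
  simp only [gridPoint]; push_cast; ring

/-- Increments of a continuous path over the mesh of the grid are uniformly small. -/
theorem eventually_abs_sub_le {f : ℝ≥0 → ℝ} (hf : Continuous f) (t : ℝ≥0) {N : ℕ → ℕ}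
    (hN : Tendsto N atTop atTop) {ε : ℝ} (hε : 0 < ε) :
    ∀ᶠ n in atTop, ∀ u ≤ t, ∀ v ≤ t, |(u : ℝ) - v| ≤ t / N n → |f u - f v| ≤ ε := by
  have hu := (isCompact_Icc (a := (0 : ℝ≥0)) (b := t)).uniformContinuousOn_of_continuous
    hf.continuousOn
  obtain ⟨δ, hδ, h⟩ := Metric.uniformContinuousOn_iff_le.1 hu ε hε
  have ht : Tendsto (fun n ↦ (t : ℝ) / N n) atTop (𝓝 0) :=
    (tendsto_natCast_atTop_atTop.comp hN).const_div_atTop _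
  filter_upwards [ht.eventually_le_const hδ] with n hn u hu v hv huv
  exact h u ⟨zero_le, hu⟩ v ⟨zero_le, hv⟩ (by rw [NNReal.dist_eq]; linarith)

theorem exists_abs_le {f : ℝ≥0 → ℝ} (hf : Continuous f) (t : ℝ≥0) :
    ∃ C, 0 ≤ C ∧ ∀ u ≤ t, |f u| ≤ C := by
  obtain ⟨C, hC⟩ := (isCompact_Icc (a := (0 : ℝ≥0)) (b := t)).exists_bound_of_continuousOn
    hf.continuousOn
  exact ⟨C, (abs_nonneg _).trans (hC 0 (by simp)), fun u hu ↦ hC u ⟨zero_le, hu⟩⟩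

/-! ### Second-order expansion of one Euler step. -/

/-- With `exp (-u) = 1 - u + u² / 2 + r` and `|r| ≤ (2 / 9) |u|³`, the left side is `u³ / 2 + (1 +
u) r`, and `1 / 2 + 2 * (2 / 9) < 1`. -/
theorem abs_one_add_mul_exp_neg_le {u : ℝ} (hu : |u| ≤ 1) :
    |(1 + u) * Real.exp (-u) - 1 + u ^ 2 / 2| ≤ |u| ^ 3 := by
  have h := Real.exp_bound (x := -u) (by simpa using hu) (n := 3) (by norm_num)
  norm_num [Finset.sum_range_succ, Nat.factorial] at h
  set r := Real.exp (-u) - (1 + -u + u ^ 2 / 2) with hr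
  have he : Real.exp (-u) = 1 - u + u ^ 2 / 2 + r := by rw [hr]; ring
  have e : (1 + u) * Real.exp (-u) - 1 + u ^ 2 / 2 = u ^ 3 / 2 + (1 + u) * r := by
    rw [he]; ring
  rw [e]
  have h1 : |1 + u| ≤ 2 := by
    have := abs_add_le 1 u
    rw [abs_one] at this; linarith
  calc |u ^ 3 / 2 + (1 + u) * r| ≤ |u ^ 3 / 2| + |(1 + u) * r| := abs_add_le _ _
    _ = |u| ^ 3 / 2 + |1 + u| * |r| := by rw [abs_div, abs_pow, abs_mul]; norm_num
    _ ≤ |u| ^ 3 / 2 + 2 * (|u| ^ 3 * (2 / 9)) := by gcongr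
    _ ≤ |u| ^ 3 := by nlinarith [pow_nonneg (abs_nonneg u) 3]

/-- One step of the Itô expansion of `S * Y`, where `S` follows the Euler scheme of the
log-normal equation and `Y` is the inverse of the explicit solution. -/
theorem abs_euler_mul_exp_le (μ σ : ℝ) :
    ∃ L, 0 ≤ L ∧ ∃ ε₀ > 0, ∀ ε ≤ ε₀, ∀ Δ d : ℝ, 0 ≤ Δ → Δ ≤ ε → |d| ≤ ε →
      |(1 + μ * Δ + σ * d) * Real.exp (-((μ - σ ^ 2 / 2) * Δ + σ * d)) - 1
        + σ ^ 2 / 2 * (d ^ 2 - Δ)| ≤ L * ε * (d ^ 2 + Δ) := by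
  set c := 1 + |μ| + |σ| + σ ^ 2 with hc
  have hμ0 := abs_nonneg μ
  have hσ0 := abs_nonneg σ
  have hsq := sq_nonneg σ
  have hc1 : 1 ≤ c := by linarith
  have hμc : |μ| ≤ c := by linarith
  have hσc : |σ| ≤ c := by linarith
  have hσ2 : σ ^ 2 ≤ c := by linarith
  have hmc : |μ| + |σ| ≤ c := by linarith
  clear_value c
  -- The bound `1 / c` ensures `c * ε ≤ 1`. The four error terms below add up to at most `(2 c² + 8
  -- c³) ε (d² + Δ)`, so `20 c³` is generous.
  refine ⟨20 * c ^ 3, by positivity, 1 / c, by positivity, fun ε hε Δ d hΔ0 hΔ hd ↦ ?_⟩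
  have hε0 : 0 ≤ ε := hΔ0.trans hΔ
  have hcε : c * ε ≤ 1 := by rw [le_div_iff₀ (by linarith)] at hε; linarith
  set u := μ * Δ + σ * d with hu
  set h := σ ^ 2 / 2 * Δ with hh
  have hu1 : |u| ≤ c * ε := by
    calc |u| ≤ |μ| * |Δ| + |σ| * |d| := by
          rw [← abs_mul, ← abs_mul]; exact abs_add_le _ _
      _ ≤ |μ| * ε + |σ| * ε := by rw [abs_of_nonneg hΔ0]; gcongr
      _ ≤ c * ε := by rw [← add_mul]; gcongr
  have hh0 : 0 ≤ h := by positivity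
  have hh1 : h ≤ c * Δ := mul_le_mul_of_nonneg_right (by linarith) hΔ0
  have hh2 : h ≤ c * ε := hh1.trans (by gcongr)
  have hΔ1 : Δ ≤ 1 := (hΔ.trans (le_mul_of_one_le_left hε0 hc1)).trans hcε
  have hΔ2 : Δ ^ 2 ≤ Δ := by nlinarith
  have hq : 0 ≤ d ^ 2 + Δ := by positivity
  have husq : u ^ 2 ≤ 2 * c ^ 2 * (d ^ 2 + Δ) := by
    have a1 : μ ^ 2 ≤ c ^ 2 := by rw [← sq_abs]; gcongr
    have a2 : σ ^ 2 ≤ c ^ 2 := by rw [← sq_abs]; gcongr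
    calc u ^ 2 ≤ 2 * (μ ^ 2 * Δ ^ 2 + σ ^ 2 * d ^ 2) := by
          nlinarith [sq_nonneg (μ * Δ - σ * d)]
      _ ≤ 2 * (c ^ 2 * Δ + c ^ 2 * d ^ 2) := by gcongr
      _ = _ := by ring
  have ha := abs_one_add_mul_exp_neg_le (hu1.trans hcε)
  have hb := Real.abs_exp_sub_one_sub_id_le (x := h) (by
    rw [abs_of_nonneg hh0]; linarith)
  set a := (1 + u) * Real.exp (-u) - 1 + u ^ 2 / 2 with haa
  set b := Real.exp h - 1 - h with hbb
  have hexp : (1 + μ * Δ + σ * d) * Real.exp (-((μ - σ ^ 2 / 2) * Δ + σ * d)) =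
      (1 - u ^ 2 / 2 + a) * (1 + h + b) := by
    have e1 : -((μ - σ ^ 2 / 2) * Δ + σ * d) = -u + h := by rw [hu, hh]; ring
    rw [e1, Real.exp_add, haa, hbb, hu]; ring
  -- The terms `h` and `σ² d² / 2` cancel: `u² / 2` differs from `σ² d² / 2` only by the last, mixed
  -- term.
  have hid : (1 + μ * Δ + σ * d) * Real.exp (-((μ - σ ^ 2 / 2) * Δ + σ * d)) - 1
        + σ ^ 2 / 2 * (d ^ 2 - Δ) =
      b + (-(u ^ 2 / 2 * (h + b))) + a * (1 + h + b) + (-(μ * Δ * (σ * d + μ * Δ / 2))) := by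
    rw [hexp, hh, hu]; ring
  clear_value a b u h
  have hb1 : |b| ≤ c * ε * (c * (d ^ 2 + Δ)) := by
    calc |b| ≤ h ^ 2 := hb
      _ = h * h := by ring
      _ ≤ (c * ε) * (c * Δ) := by gcongr
      _ ≤ _ := by gcongr; linarith [sq_nonneg d]
  have hb2 : |b| ≤ c * ε := by
    calc |b| ≤ h ^ 2 := hb
      _ = h * h := by ring
      _ ≤ (c * ε) * 1 := by gcongr; linarith
      _ = _ := by ring
  have hb3 : |h + b| ≤ 2 * (c * ε) := by
    calc |h + b| ≤ |h| + |b| := abs_add_le _ _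
      _ ≤ _ := by rw [abs_of_nonneg hh0]; linarith
  have hb4 : |1 + h + b| ≤ 3 := by
    calc |1 + h + b| = |1 + (h + b)| := by ring_nf
      _ ≤ |1| + |h + b| := abs_add_le _ _
      _ ≤ 3 := by rw [abs_one]; linarith
  have t2 : |-(u ^ 2 / 2 * (h + b))| ≤ 2 * c ^ 2 * (d ^ 2 + Δ) / 2 * (2 * (c * ε)) := by
    rw [abs_neg, abs_mul, abs_of_nonneg (by positivity : (0 : ℝ) ≤ u ^ 2 / 2)]; gcongr
  have t3 : |a * (1 + h + b)| ≤ (c * ε * (2 * c ^ 2 * (d ^ 2 + Δ))) * 3 := by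
    rw [abs_mul]
    have : |u| ^ 3 ≤ c * ε * (2 * c ^ 2 * (d ^ 2 + Δ)) := by
      calc |u| ^ 3 = |u| * u ^ 2 := by rw [← sq_abs u]; ring
        _ ≤ _ := by gcongr
    gcongr
    exact ha.trans this
  have t4 : |-(μ * Δ * (σ * d + μ * Δ / 2))| ≤ c * (d ^ 2 + Δ) * (c * ε) := by
    rw [abs_neg, abs_mul, abs_mul, abs_of_nonneg hΔ0]
    have : |σ * d + μ * Δ / 2| ≤ c * ε := by
      calc |σ * d + μ * Δ / 2| ≤ |σ * d| + |μ * Δ / 2| := abs_add_le _ _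
        _ = |σ| * |d| + |μ| * Δ / 2 := by
          rw [abs_mul, abs_div, abs_mul, abs_of_nonneg hΔ0]; norm_num
        _ ≤ |σ| * ε + |μ| * ε := by
          have : |μ| * Δ / 2 ≤ |μ| * Δ := by have := mul_nonneg (abs_nonneg μ) hΔ0; linarith
          have : |μ| * Δ ≤ |μ| * ε := by gcongr
          have : |σ| * |d| ≤ |σ| * ε := by gcongr
          linarith
        _ ≤ c * ε := by rw [← add_mul, add_comm]; gcongr
    gcongr
    linarith [sq_nonneg d]
  rw [hid]
  have hcc : c ^ 2 ≤ c ^ 3 := pow_le_pow_right₀ hc1 (by norm_num)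
  have hk : c ^ 2 * (ε * (d ^ 2 + Δ)) ≤ c ^ 3 * (ε * (d ^ 2 + Δ)) := by gcongr
  calc _ ≤ |b + -(u ^ 2 / 2 * (h + b)) + a * (1 + h + b)| + |-(μ * Δ * (σ * d + μ * Δ / 2))| :=
        abs_add_le _ _
    _ ≤ |b| + |-(u ^ 2 / 2 * (h + b))| + |a * (1 + h + b)| + |-(μ * Δ * (σ * d + μ * Δ / 2))| := by
        gcongr
        exact abs_add_three _ _ _
    _ ≤ _ := by linarith [t2, t3, t4, hb1, mul_nonneg (pow_nonneg (zero_le_one.trans hc1) 3) (mul_nonneg hε0 hq)]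

/-! ### Pathwise uniqueness along one sequence of grids. -/

theorem sum_range_mul_eq {M : Type*} [AddCommMonoid M] (f : ℕ → M) (a m : ℕ) :
    ∑ j ∈ Finset.range (a * m), f j =
      ∑ i ∈ Finset.range a, ∑ l ∈ Finset.range m, f (i * m + l) := by
  induction a with
  | zero => simp
  | succ a ih => rw [Finset.sum_range_succ, ← ih, add_mul, one_mul, Finset.sum_range_add]

theorem tendsto_zero_of_eventually_abs_le {x : ℕ → ℝ} (A : ℝ) (hA : 0 ≤ A) {ε₀ : ℝ} (hε₀ : 0 < ε₀)
    (h : ∀ ε, 0 < ε → ε ≤ ε₀ → ∀ᶠ n in atTop, |x n| ≤ A * ε) : Tendsto x atTop (𝓝 0) := by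
  refine Metric.tendsto_atTop'.2 fun η hη ↦ ?_
  have hε : 0 < min ε₀ (η / (A + 1)) := by positivity
  obtain ⟨n₀, hn₀⟩ := eventually_atTop.1 (h _ hε (min_le_left _ _))
  refine ⟨n₀, fun n hn ↦ ?_⟩
  rw [dist_zero_right, Real.norm_eq_abs]
  calc |x n| ≤ A * min ε₀ (η / (A + 1)) := hn₀ n hn.le
    _ ≤ A * (η / (A + 1)) := by gcongr; exact min_le_right _ _
    _ < η := by rw [← mul_div_assoc, div_lt_iff₀ (by positivity)]; nlinarith

/-- The increment of `s - ∫ μ s` over the `i`-th interval of the grid, minus the Euler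
approximation `σ s Δw` of the stochastic integral. -/
noncomputable def eulerError (s w : ℝ≥0 → ℝ) (μ σ : ℝ) (t : ℝ≥0) (N i : ℕ) : ℝ :=
  s (gridPoint t N (i + 1)) - s (gridPoint t N i)
    - (∫ u in (gridPoint t N i : ℝ)..gridPoint t N (i + 1), μ * s u.toNNReal)
    - σ * s (gridPoint t N i) * (w (gridPoint t N (i + 1)) - w (gridPoint t N i))

/-- The inverse of the explicit solution of the log-normal equation. -/
noncomputable def discount (w : ℝ≥0 → ℝ) (μ σ : ℝ) (u : ℝ≥0) : ℝ :=
  Real.exp (-((μ - σ ^ 2 / 2) * u + σ * w u))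

theorem continuous_discount {w : ℝ≥0 → ℝ} (hw : Continuous w) (μ σ : ℝ) :
    Continuous (discount w μ σ) := by unfold discount; fun_prop

theorem gridPoint_abs_sub (t : ℝ≥0) (N i : ℕ) :
    |(gridPoint t N (i + 1) : ℝ) - gridPoint t N i| = t / N := by
  rw [gridPoint_succ, add_sub_cancel_left, abs_of_nonneg (by positivity)]

theorem abs_integral_sub_le {s : ℝ≥0 → ℝ} (hs : Continuous s) (μ : ℝ) (t : ℝ≥0) {N i : ℕ}
    (hi : i < N) {ε : ℝ}
    (h : ∀ u ≤ t, ∀ v ≤ t, |(u : ℝ) - v| ≤ t / N → |s u - s v| ≤ ε) :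
    |(∫ u in (gridPoint t N i : ℝ)..gridPoint t N (i + 1), μ * s u.toNNReal)
      - μ * s (gridPoint t N i) * (t / N)| ≤ |μ| * ε * (t / N) := by
  have hle : (gridPoint t N i : ℝ) ≤ gridPoint t N (i + 1) := by
    exact_mod_cast gridPoint_mono t N i.le_succ
  have hc : μ * s (gridPoint t N i) * (t / N) =
      ∫ _ in (gridPoint t N i : ℝ)..gridPoint t N (i + 1), μ * s (gridPoint t N i) := by
    rw [intervalIntegral.integral_const, gridPoint_succ, add_sub_cancel_left, smul_eq_mul, mul_comm]
  have hcont : Continuous fun u : ℝ ↦ μ * s u.toNNReal := by fun_prop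
  rw [hc, ← intervalIntegral.integral_sub (hcont.intervalIntegrable _ _)
    (continuous_const.intervalIntegrable _ _)]
  rw [← gridPoint_abs_sub t N i, ← Real.norm_eq_abs]
  refine intervalIntegral.norm_integral_le_of_norm_le_const fun u hu ↦ ?_
  rw [Set.uIoc_of_le hle] at hu
  have hu0 : 0 ≤ u := (NNReal.coe_nonneg _).trans hu.1.le
  rw [← mul_sub, norm_mul, Real.norm_eq_abs, Real.norm_eq_abs]
  gcongr
  refine h _ ?_ _ (gridPoint_le t hi.le) ?_
  · rw [Real.toNNReal_le_iff_le_coe]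
    exact hu.2.trans (by exact_mod_cast gridPoint_le t hi)
  · rw [Real.coe_toNNReal _ hu0, abs_of_nonneg (by linarith [hu.1])]
    linarith [hu.2, gridPoint_succ t N i]

/-- A continuous path `s` that satisfies the log-normal equation driven by the path `w`, in the
sense of the following limits along uniform subdivisions, is the explicit solution. -/
theorem mul_discount_eq {s w : ℝ≥0 → ℝ} (hs : Continuous s) (hw : Continuous w) (μ σ : ℝ) (t : ℝ≥0)
    {N : ℕ → ℕ} (hN : Tendsto N atTop atTop) (hN0 : ∀ n, N n ≠ 0)
    (h1 : Tendsto (fun n ↦ ∑ i ∈ Finset.range (N n),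
      discount w μ σ (gridPoint t (N n) i) * eulerError s w μ σ t (N n) i) atTop (𝓝 0))
    (h2 : Tendsto (fun n ↦ ∑ i ∈ Finset.range (N n),
      eulerError s w μ σ t (N n) i ^ 2) atTop (𝓝 0))
    (h3 : Tendsto (fun n ↦ ∑ i ∈ Finset.range (N n),
      s (gridPoint t (N n) i) * discount w μ σ (gridPoint t (N n) i) *
        ((w (gridPoint t (N n) (i + 1)) - w (gridPoint t (N n) i)) ^ 2 - t / N n)) atTop (𝓝 0))
    (h4 : Tendsto (fun n ↦ ∑ i ∈ Finset.range (N n),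
      ((w (gridPoint t (N n) (i + 1)) - w (gridPoint t (N n) i)) ^ 2 - t / N n)) atTop (𝓝 0)) :
    s t * discount w μ σ t = s 0 * discount w μ σ 0 := by
  set y := discount w μ σ with hy
  obtain ⟨Cs, hCs0, hCs⟩ := exists_abs_le hs t
  obtain ⟨Cy, hCy0, hCy⟩ := exists_abs_le (continuous_discount hw μ σ) t
  obtain ⟨L, hL0, ε₀, hε₀, hL⟩ := abs_euler_mul_exp_le μ σ
  let p n i := gridPoint t (N n) i
  let dw n i := w (p n (i + 1)) - w (p n i)
  let Δ n : ℝ := t / N n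
  let R n i := eulerError s w μ σ t (N n) i
  let K n i := (∫ u in (p n i : ℝ)..p n (i + 1), μ * s u.toNNReal) - μ * s (p n i) * Δ n
  let θ n i := (1 + μ * Δ n + σ * dw n i) *
    Real.exp (-((μ - σ ^ 2 / 2) * Δ n + σ * dw n i)) - 1 + σ ^ 2 / 2 * (dw n i ^ 2 - Δ n)
  have hp {n i} (hi : i ≤ N n) : p n i ≤ t := gridPoint_le t hi
  have hΔ0 n : 0 ≤ Δ n := by positivity
  have hΔsum n : ∑ i ∈ Finset.range (N n), Δ n = t := by
    have : (N n : ℝ) ≠ 0 := by exact_mod_cast hN0 n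
    simp only [Finset.sum_const, Finset.card_range, nsmul_eq_mul, Δ]
    field_simp
  have hΔt : Tendsto Δ atTop (𝓝 0) := (tendsto_natCast_atTop_atTop.comp hN).const_div_atTop _
  have hdw {ε : ℝ} (hε : 0 < ε) : ∀ᶠ n in atTop, ∀ i < N n, |dw n i| ≤ ε := by
    filter_upwards [eventually_abs_sub_le hw t hN hε] with n hn i hi
    exact hn _ (hp hi) _ (hp hi.le) (gridPoint_abs_sub t _ _).le
  -- By `h4` the squared increments eventually sum to at most `t + 1`, and the time steps sum to
  -- `t`.
  have hQ : ∀ᶠ n in atTop, ∑ i ∈ Finset.range (N n), (dw n i ^ 2 + Δ n) ≤ 2 * t + 1 := by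
    filter_upwards [h4.eventually_le_const one_pos] with n hn
    rw [Finset.sum_sub_distrib] at hn
    rw [Finset.sum_add_distrib]
    have := hΔsum n
    simp only [Δ, dw, p] at this ⊢
    linarith
  have hρ n i : y (p n (i + 1)) = y (p n i) *
      Real.exp (-((μ - σ ^ 2 / 2) * Δ n + σ * dw n i)) := by
    simp only [hy, discount, p, dw, Δ]
    rw [← Real.exp_add, gridPoint_succ]
    congr 1
    ring
  have c1 : Tendsto (fun n ↦ ∑ i ∈ Finset.range (N n), s (p n i) * y (p n i) * θ n i)
      atTop (𝓝 0) := by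
    refine tendsto_zero_of_eventually_abs_le (Cs * Cy * L * (2 * t + 1)) (by positivity) hε₀ ?_
    intro ε hε hεε
    filter_upwards [hΔt.eventually_le_const hε, hdw hε, hQ] with n hn1 hn2 hn3
    calc |∑ i ∈ Finset.range (N n), s (p n i) * y (p n i) * θ n i|
        ≤ ∑ i ∈ Finset.range (N n), |s (p n i) * y (p n i) * θ n i| :=
          Finset.abs_sum_le_sum_abs _ _
      _ ≤ ∑ i ∈ Finset.range (N n), Cs * Cy * (L * ε * (dw n i ^ 2 + Δ n)) := by
          refine Finset.sum_le_sum fun i hi ↦ ?_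
          rw [Finset.mem_range] at hi
          rw [abs_mul, abs_mul]
          gcongr
          · exact hCs _ (hp hi.le)
          · exact hCy _ (hp hi.le)
          · exact hL ε hεε _ _ (hΔ0 n) hn1 (hn2 i hi)
      _ = Cs * Cy * L * ε * ∑ i ∈ Finset.range (N n), (dw n i ^ 2 + Δ n) := by
          rw [Finset.mul_sum]; exact Finset.sum_congr rfl fun i _ ↦ by ring
      _ ≤ Cs * Cy * L * ε * (2 * t + 1) := by gcongr
      _ = _ := by ring
  have c2 : Tendsto (fun n ↦ ∑ i ∈ Finset.range (N n), K n i * y (p n (i + 1)))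
      atTop (𝓝 0) := by
    refine tendsto_zero_of_eventually_abs_le (|μ| * Cy * t) (by positivity) one_pos ?_
    intro ε hε _
    filter_upwards [eventually_abs_sub_le hs t hN hε] with n hn
    calc |∑ i ∈ Finset.range (N n), K n i * y (p n (i + 1))|
        ≤ ∑ i ∈ Finset.range (N n), |K n i * y (p n (i + 1))| := Finset.abs_sum_le_sum_abs _ _
      _ ≤ ∑ i ∈ Finset.range (N n), |μ| * ε * Δ n * Cy := by
          refine Finset.sum_le_sum fun i hi ↦ ?_
          rw [Finset.mem_range] at hi
          rw [abs_mul]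
          gcongr
          · exact abs_integral_sub_le hs μ t hi hn
          · exact hCy _ (hp hi)
      _ = |μ| * ε * Cy * ∑ i ∈ Finset.range (N n), Δ n := by
          rw [Finset.mul_sum]; exact Finset.sum_congr rfl fun i _ ↦ by ring
      _ = _ := by rw [hΔsum]; ring
  have c3 : Tendsto (fun n ↦ ∑ i ∈ Finset.range (N n), R n i * (y (p n (i + 1)) - y (p n i)))
      atTop (𝓝 0) := by
    set m := μ - σ ^ 2 / 2 with hm
    set D := 2 * (m ^ 2 + σ ^ 2) with hD
    have hD0 : 0 ≤ D := by positivity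
    -- Young's inequality `|r q| ≤ r² / (2 ε) + ε q² / 2` is used with `∑ R² ≤ ε²`, which `h2`
    -- provides eventually; the second part is `ε` times the bounded quadratic sum of the increments
    -- of `y`.
    refine tendsto_zero_of_eventually_abs_le (1 / 2 + 2 * Cy ^ 2 * D * (2 * t + 1))
      (by positivity) (ε₀ := min 1 (1 / (1 + |m| + |σ|))) (by positivity) ?_
    intro ε hε hεε
    have hε1 : ε ≤ 1 := hεε.trans (min_le_left _ _)
    have hε2 : (1 + |m| + |σ|) * ε ≤ 1 := by
      have := hεε.trans (min_le_right _ _)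
      rw [le_div_iff₀ (by positivity)] at this
      linarith
    filter_upwards [hΔt.eventually_le_const hε, hdw hε, hQ,
      h2.eventually_le_const (pow_pos hε 2)] with n hn1 hn2 hn3 hn4
    have hdy : ∀ i < N n, (y (p n (i + 1)) - y (p n i)) ^ 2 ≤
        Cy ^ 2 * (4 * (D * (dw n i ^ 2 + Δ n))) := by
      intro i hi
      set z := -(m * Δ n + σ * dw n i) with hz
      have hz1 : |z| ≤ 1 := by
        calc |z| ≤ |m * Δ n| + |σ * dw n i| := by rw [hz, abs_neg]; exact abs_add_le _ _
          _ = |m| * Δ n + |σ| * |dw n i| := by rw [abs_mul, abs_mul, abs_of_nonneg (hΔ0 n)]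
          _ ≤ |m| * ε + |σ| * ε := by gcongr; exact hn2 i hi
          _ ≤ 1 := by linarith
      have hz2 : z ^ 2 ≤ D * (dw n i ^ 2 + Δ n) := by
        have hΔ2 : Δ n ^ 2 ≤ Δ n := by
          have := hΔ0 n
          nlinarith
        have a1 : z ^ 2 ≤ 2 * (m ^ 2 * Δ n ^ 2 + σ ^ 2 * dw n i ^ 2) := by
          rw [hz]; nlinarith only [sq_nonneg (m * Δ n - σ * dw n i)]
        have a2 : m ^ 2 * Δ n ^ 2 ≤ m ^ 2 * Δ n := by gcongr
        have a3 : 0 ≤ m ^ 2 * dw n i ^ 2 := by positivity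
        have a4 : 0 ≤ σ ^ 2 * Δ n := mul_nonneg (sq_nonneg _) (hΔ0 n)
        rw [hD]
        linarith
      have he := Real.abs_exp_sub_one_le hz1
      have : y (p n (i + 1)) - y (p n i) = y (p n i) * (Real.exp z - 1) := by
        rw [hρ]; ring
      rw [this, mul_pow]
      gcongr ?_ * ?_
      · rw [← sq_abs]
        gcongr
        exact hCy _ (hp hi.le)
      · calc (Real.exp z - 1) ^ 2 = |Real.exp z - 1| ^ 2 := (sq_abs _).symm
          _ ≤ (2 * |z|) ^ 2 := by gcongr
          _ = 4 * z ^ 2 := by rw [mul_pow, sq_abs]; ring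
          _ ≤ _ := by gcongr
    calc |∑ i ∈ Finset.range (N n), R n i * (y (p n (i + 1)) - y (p n i))|
        ≤ ∑ i ∈ Finset.range (N n), |R n i * (y (p n (i + 1)) - y (p n i))| :=
          Finset.abs_sum_le_sum_abs _ _
      _ ≤ ∑ i ∈ Finset.range (N n), (1 / (2 * ε) * R n i ^ 2 +
            ε / 2 * (Cy ^ 2 * (4 * (D * (dw n i ^ 2 + Δ n))))) := by
          refine Finset.sum_le_sum fun i hi ↦ ?_
          rw [Finset.mem_range] at hi
          refine le_trans ?_ (add_le_add_right (mul_le_mul_of_nonneg_left (hdy i hi)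
            (by positivity : 0 ≤ ε / 2)) _)
          set r := R n i
          set q := y (p n (i + 1)) - y (p n i)
          rw [abs_mul, ← sq_abs r, ← sq_abs q]
          have h0 : 0 ≤ (|r| - ε * |q|) ^ 2 / (2 * ε) := by positivity
          have h1 : (|r| - ε * |q|) ^ 2 / (2 * ε) =
              1 / (2 * ε) * |r| ^ 2 + ε / 2 * |q| ^ 2 - |r| * |q| := by
            field_simp; ring
          linarith
      _ = 1 / (2 * ε) * ∑ i ∈ Finset.range (N n), R n i ^ 2 +
            2 * ε * Cy ^ 2 * D * ∑ i ∈ Finset.range (N n), (dw n i ^ 2 + Δ n) := by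
          rw [Finset.sum_add_distrib, Finset.mul_sum, Finset.mul_sum]
          congr 1
          exact Finset.sum_congr rfl fun i _ ↦ by ring
      _ ≤ 1 / (2 * ε) * ε ^ 2 + 2 * ε * Cy ^ 2 * D * (2 * t + 1) := by gcongr
      _ = _ := by field_simp
  -- Discrete product rule. The left side does not depend on `n`, and every sum on the right tends
  -- to `0`.
  have htel n : s t * y t - s 0 * y 0 =
      ∑ i ∈ Finset.range (N n), s (p n i) * y (p n i) * θ n i
      - σ ^ 2 / 2 * ∑ i ∈ Finset.range (N n), s (p n i) * y (p n i) * (dw n i ^ 2 - Δ n)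
      + ∑ i ∈ Finset.range (N n), K n i * y (p n (i + 1))
      + ∑ i ∈ Finset.range (N n), y (p n i) * R n i
      + ∑ i ∈ Finset.range (N n), R n i * (y (p n (i + 1)) - y (p n i)) := by
    have e := Finset.sum_range_sub (fun i ↦ s (p n i) * y (p n i)) (N n)
    simp only [p, gridPoint_zero, gridPoint_self t (hN0 n)] at e
    rw [← e, Finset.mul_sum, ← Finset.sum_sub_distrib, ← Finset.sum_add_distrib,
      ← Finset.sum_add_distrib, ← Finset.sum_add_distrib]
    refine Finset.sum_congr rfl fun i _ ↦ ?_
    have hR : s (p n (i + 1)) = s (p n i) + (K n i + μ * s (p n i) * Δ n)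
        + σ * s (p n i) * dw n i + R n i := by
      simp only [K, R, eulerError, dw, p, Δ]; ring
    change s (p n (i + 1)) * y (p n (i + 1)) - s (p n i) * y (p n i) = _
    rw [hR, hρ]
    simp only [θ]
    ring
  have hlim := (((c1.sub (h3.const_mul (σ ^ 2 / 2))).add c2).add h1).add c3
  have := tendsto_nhds_unique (tendsto_const_nhds (x := s t * y t - s 0 * y 0))
    (hlim.congr fun n ↦ (htel n).symm)
  linarith

/-! ### Diagonal choice, and Wiener increments as noise. -/

theorem TendstoInMeasure.exists_diagonal {Ω : Type*} {mΩ : MeasurableSpace Ω} {P : Measure Ω}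
    [IsProbabilityMeasure P] {F : ℕ → ℕ → Ω → ℝ} (h : ∀ n, TendstoInMeasure P (F n) atTop 0) :
    ∃ m : ℕ → ℕ, TendstoInMeasure P (fun n ↦ F n (m n)) atTop 0 := by
  have h' (n : ℕ) : ∃ m, P.real {ω | 1 / ((n : ℝ) + 1) ≤ |F n m ω|} ≤ 1 / ((n : ℝ) + 1) := by
    have := tendstoInMeasure_iff_measureReal_norm.1 (h n) (1 / ((n : ℝ) + 1)) (by positivity)
    obtain ⟨m, hm⟩ := (this.eventually_le_const (u := 1 / ((n : ℝ) + 1)) (by positivity)).exists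
    exact ⟨m, by simpa using hm⟩
  choose m hm using h'
  refine ⟨m, tendstoInMeasure_iff_measureReal_norm.2 fun ε hε ↦ ?_⟩
  have hlim : Tendsto (fun n : ℕ ↦ 1 / ((n : ℝ) + 1)) atTop (𝓝 0) :=
    tendsto_one_div_add_atTop_nhds_zero_nat
  refine squeeze_zero' (.of_forall fun _ ↦ measureReal_nonneg) ?_ hlim
  filter_upwards [hlim.eventually_le_const hε] with n hn
  refine (measureReal_mono fun ω hω ↦ ?_).trans (hm n)
  simp only [Set.mem_ofPred_eq, Pi.zero_apply, sub_zero, Real.norm_eq_abs] at hω ⊢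
  exact hn.trans hω

section noise

variable {Ω : Type*} {mΩ : MeasurableSpace Ω} {P : Measure Ω}
  {𝓖 : Filtration ℝ≥0 mΩ} {W : ℝ≥0 → Ω → ℝ}

theorem IsWienerProcess.hasLaw_increment (hW : IsWienerProcess 𝓖 W P) (t : ℝ≥0) (N k : ℕ) :
    HasLaw (fun ω ↦ W (gridPoint t N (k + 1)) ω - W (gridPoint t N k) ω)
      (gaussianReal 0 (t / N)) P := by
  have h := hW.hasLaw_sub (gridPoint t N (k + 1)) (gridPoint t N k)
  have e : nndist (gridPoint t N (k + 1)).1 (gridPoint t N k).1 = t / N := by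
    ext
    rw [coe_nndist, Real.dist_eq]
    exact gridPoint_abs_sub t N k
  rw [e] at h
  exact h

theorem IsWienerProcess.isCenteredNoise_increment (hW : IsWienerProcess 𝓖 W P) (t : ℝ≥0) (N : ℕ) :
    IsCenteredNoise P (fun k ↦ 𝓖 (gridPoint t N k))
      (fun k ω ↦ W (gridPoint t N (k + 1)) ω - W (gridPoint t N k) ω) (t / N) where
  mono _ _ h := 𝓖.mono (gridPoint_mono t N h)
  le _ := 𝓖.le _
  measurable k := (hW.adapted _).sub
    ((hW.adapted _).mono (𝓖.mono (gridPoint_mono t N k.le_succ)) le_rfl)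
  memLp k := (hW.hasLaw_increment t N k).hasGaussianLaw.memLp_two
  integral_eq_zero k := by
    rw [(hW.hasLaw_increment t N k).integral_eq, integral_id_gaussianReal]
  integral_sq_le k := by
    have h := hW.hasLaw_increment t N k
    have := h.isProbabilityMeasure
    have hv := h.variance_eq
    rw [variance_id_gaussianReal, variance_of_integral_eq_zero h.aemeasurable
      (by rw [h.integral_eq, integral_id_gaussianReal])] at hv
    exact hv.le.trans_eq (by push_cast; rfl)
  indep k := hW.indep_increment _ _ (gridPoint_mono t N k.le_succ)

/-- Scaling by `√v`. Only the order `v²` matters later; the value of the constant integral is never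
needed. -/
theorem integral_sq_sub_sq_gaussianReal (v : ℝ≥0) :
    ∫ x, (x ^ 2 - v) ^ 2 ∂(gaussianReal 0 v) =
      v ^ 2 * ∫ z, (z ^ 2 - 1) ^ 2 ∂(gaussianReal 0 1) := by
  have h := gaussianReal_map_const_mul (μ := 0) (v := 1) (√v)
  have e : NNReal.mk (√v ^ 2) (sq_nonneg _) * 1 = v := by
    ext; simp
  rw [mul_zero, e] at h
  rw [← h, integral_map (by fun_prop) (Continuous.aestronglyMeasurable (by fun_prop)),
    ← integral_const_mul]
  congr 1 with z
  rw [mul_pow, Real.sq_sqrt v.coe_nonneg]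
  ring

/-- The variance is of order `(t / N)²`, so the total over `N` steps is `O(1 / N)`: this is what
makes the quadratic variation converge. -/
theorem IsWienerProcess.isCenteredNoise_increment_sq (hW : IsWienerProcess 𝓖 W P) (t : ℝ≥0)
    (N : ℕ) :
    IsCenteredNoise P (fun k ↦ 𝓖 (gridPoint t N k))
      (fun k ω ↦ (W (gridPoint t N (k + 1)) ω - W (gridPoint t N k) ω) ^ 2 - t / N)
      ((t / N) ^ 2 * ∫ z, (z ^ 2 - 1) ^ 2 ∂(gaussianReal 0 1)) where
  mono := (hW.isCenteredNoise_increment t N).mono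
  le _ := 𝓖.le _
  measurable k := (((hW.isCenteredNoise_increment t N).measurable k).pow_const 2).sub_const _
  memLp k := by
    have h := (hW.hasLaw_increment t N k).hasGaussianLaw
    have := h.isProbabilityMeasure
    have h4 : MemLp (fun ω ↦ W (gridPoint t N (k + 1)) ω - W (gridPoint t N k) ω) 4 P :=
      h.memLp (by norm_num)
    have h2 := h4.mul (p := 4) (q := 4) (r := 2) h4
      (hpqr := ⟨by
        rw [← two_mul, show (4 : ENNReal) = 2 * 2 by norm_num,
          ENNReal.mul_inv (by simp) (by simp), ← mul_assoc, ENNReal.mul_inv_cancel (by simp)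
          (by simp), one_mul]⟩)
    refine MemLp.sub ?_ (memLp_const _)
    simpa [pow_two] using! h2
  integral_eq_zero k := by
    have hn := hW.isCenteredNoise_increment t N
    have h := hW.hasLaw_increment t N k
    have := h.isProbabilityMeasure
    have hv := h.variance_eq
    rw [variance_id_gaussianReal, variance_of_integral_eq_zero h.aemeasurable
      (by rw [h.integral_eq, integral_id_gaussianReal])] at hv
    rw [integral_sub (hn.memLp k).integrable_sq (integrable_const _), hv]
    simp
  integral_sq_le k := by
    have h := (hW.hasLaw_increment t N k).integral_comp (f := fun x ↦ (x ^ 2 - (t / N)) ^ 2)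
      (Continuous.aestronglyMeasurable (by fun_prop))
    simp only [Function.comp_def] at h
    have h2 := integral_sq_sub_sq_gaussianReal (t / N)
    push_cast at h2
    rw [h, h2]
  indep k := by
    refine indep_of_indep_of_le_left ((hW.isCenteredNoise_increment t N).indep k) ?_
    exact (Measurable.sub_const (Measurable.pow_const (comap_measurable _) 2) _).comap_le

end noise

/-! ### Coarse and fine grids. -/

/-- The uniform subdivision of `[0, gridPoint t N i]` into `i * (m + 1)` intervals. -/
noncomputable def gridSubdivision (t : ℝ≥0) (N i m : ℕ) : TimeSubdivision (gridPoint t N i) where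
  size := i * (m + 1)
  point := gridPoint t (N * (m + 1))
  mono := gridPoint_mono _ _
  point_zero := gridPoint_zero _ _
  point_size := gridPoint_mul t N i m.succ_ne_zero

theorem tendsto_mesh_gridSubdivision (t : ℝ≥0) {N : ℕ} (hN : N ≠ 0) (i : ℕ) :
    Tendsto (fun m ↦ (gridSubdivision t N i m).mesh) atTop (𝓝 0) := by
  have hlim : Tendsto (fun m : ℕ ↦ t / (N * (m + 1) : ℕ)) atTop (𝓝 0) := by
    refine NNReal.tendsto_coe.1 ?_
    push_cast
    exact (tendsto_atTop_add_const_right _ _ tendsto_natCast_atTop_atTop |>.const_mul_atTop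
      (by positivity : (0 : ℝ) < N)).const_div_atTop _
  refine tendsto_of_tendsto_of_tendsto_of_le_of_le tendsto_const_nhds hlim (fun _ ↦ zero_le)
    fun m ↦ Finset.sup_le fun j _ ↦ ?_
  change gridPoint _ _ _ - gridPoint _ _ _ ≤ _
  rw [gridPoint_succ_nnreal, add_tsub_cancel_left]

/-- The error of the left-endpoint sum on the fine grid for the stochastic integral. -/
noncomputable def itoError (s w : ℝ≥0 → ℝ) (μ σ : ℝ) (t : ℝ≥0) (N M i : ℕ) : ℝ :=
  ∑ j ∈ Finset.range (i * M), σ * s (gridPoint t (N * M) j) *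
    (w (gridPoint t (N * M) (j + 1)) - w (gridPoint t (N * M) j)) -
  (s (gridPoint t N i) - s 0 - ∫ u in (0 : ℝ)..gridPoint t N i, μ * s u.toNNReal)

/-- The integrand on the fine grid minus its value at the preceding point of the coarse grid. -/
noncomputable def gridDiff (s : ℝ≥0 → ℝ) (σ : ℝ) (t : ℝ≥0) (N M j : ℕ) : ℝ :=
  σ * (s (gridPoint t (N * M) j) - s (gridPoint t N (j / M)))

theorem mul_add_div_eq {i l M : ℕ} (hl : l < M) : (i * M + l) / M = i := by
  rw [add_comm, Nat.add_mul_div_right _ _ (by lia), Nat.div_eq_of_lt hl, zero_add]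

/-- The fine sum over one coarse interval is a difference of two left-endpoint sums started at `0`,
so replacing it by the exact increment costs two consecutive values of `itoError`. Freezing the
integrand at the coarse point leaves `gridDiff`. -/
theorem eulerError_eq {s : ℝ≥0 → ℝ} (hs : Continuous s) (w : ℝ≥0 → ℝ) (μ σ : ℝ) (t : ℝ≥0)
    (N : ℕ) {M : ℕ} (hM : M ≠ 0) (i : ℕ) :
    eulerError s w μ σ t N i = ∑ l ∈ Finset.range M, gridDiff s σ t N M (i * M + l) *
      (w (gridPoint t (N * M) (i * M + l + 1)) - w (gridPoint t (N * M) (i * M + l)))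
      + (itoError s w μ σ t N M i - itoError s w μ σ t N M (i + 1)) := by
  have hcont : Continuous fun u : ℝ ↦ μ * s u.toNNReal := by fun_prop
  have hint := intervalIntegral.integral_interval_sub_left
    (hcont.intervalIntegrable (μ := volume) 0 (gridPoint t N (i + 1)))
    (hcont.intervalIntegrable 0 (gridPoint t N i))
  have htel : ∑ l ∈ Finset.range M, (w (gridPoint t (N * M) (i * M + l + 1)) -
      w (gridPoint t (N * M) (i * M + l))) =
      w (gridPoint t N (i + 1)) - w (gridPoint t N i) := by
    have := Finset.sum_range_sub (fun l ↦ w (gridPoint t (N * M) (i * M + l))) M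
    rw [add_zero, gridPoint_mul t N i hM, ← add_one_mul, gridPoint_mul t N (i + 1) hM] at this
    exact this
  have hdiff : ∑ l ∈ Finset.range M, gridDiff s σ t N M (i * M + l) *
      (w (gridPoint t (N * M) (i * M + l + 1)) - w (gridPoint t (N * M) (i * M + l))) =
      ∑ l ∈ Finset.range M, σ * s (gridPoint t (N * M) (i * M + l)) *
      (w (gridPoint t (N * M) (i * M + l + 1)) - w (gridPoint t (N * M) (i * M + l)))
      - σ * s (gridPoint t N i) * (w (gridPoint t N (i + 1)) - w (gridPoint t N i)) := by
    rw [← htel, Finset.mul_sum, ← Finset.sum_sub_distrib]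
    refine Finset.sum_congr rfl fun l hl ↦ ?_
    rw [gridDiff, mul_add_div_eq (Finset.mem_range.1 hl)]
    ring
  rw [hdiff, eulerError, itoError, itoError, add_one_mul, Finset.sum_range_add, ← hint]
  ring

/-- Pathwise uniqueness, in terms of the fine grids. -/
theorem mul_discount_eq_of_blocks {s w : ℝ≥0 → ℝ} (hs : Continuous s) (hw : Continuous w)
    (μ σ : ℝ) (t : ℝ≥0) {N M : ℕ → ℕ} (hN : Tendsto N atTop atTop) (hN0 : ∀ n, N n ≠ 0)
    (hM0 : ∀ n, M n ≠ 0)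
    (hE : Tendsto (fun n ↦ ∑ i ∈ Finset.range (N n + 1), |itoError s w μ σ t (N n) (M n) i|)
      atTop (𝓝 0))
    (hB : Tendsto (fun n ↦ ∑ i ∈ Finset.range (N n), (∑ l ∈ Finset.range (M n),
      gridDiff s σ t (N n) (M n) (i * M n + l) *
      (w (gridPoint t (N n * M n) (i * M n + l + 1)) - w (gridPoint t (N n * M n) (i * M n + l))))
      ^ 2) atTop (𝓝 0))
    (hyB : Tendsto (fun n ↦ ∑ j ∈ Finset.range (N n * M n),
      discount w μ σ (gridPoint t (N n) (j / M n)) * gridDiff s σ t (N n) (M n) j *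
      (w (gridPoint t (N n * M n) (j + 1)) - w (gridPoint t (N n * M n) j))) atTop (𝓝 0))
    (h3 : Tendsto (fun n ↦ ∑ i ∈ Finset.range (N n),
      s (gridPoint t (N n) i) * discount w μ σ (gridPoint t (N n) i) *
        ((w (gridPoint t (N n) (i + 1)) - w (gridPoint t (N n) i)) ^ 2 - t / N n)) atTop (𝓝 0))
    (h4 : Tendsto (fun n ↦ ∑ i ∈ Finset.range (N n),
      ((w (gridPoint t (N n) (i + 1)) - w (gridPoint t (N n) i)) ^ 2 - t / N n)) atTop (𝓝 0)) :
    s t * discount w μ σ t = s 0 * discount w μ σ 0 := by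
  obtain ⟨C, hC0, hC⟩ := exists_abs_le (continuous_discount hw μ σ) t
  set y := discount w μ σ
  let B n i := ∑ l ∈ Finset.range (M n), gridDiff s σ t (N n) (M n) (i * M n + l) *
      (w (gridPoint t (N n * M n) (i * M n + l + 1)) - w (gridPoint t (N n * M n) (i * M n + l)))
  let e n i := itoError s w μ σ t (N n) (M n) i
  let E n := ∑ i ∈ Finset.range (N n + 1), |e n i|
  have hR n i : eulerError s w μ σ t (N n) i = B n i + (e n i - e n (i + 1)) :=
    eulerError_eq hs w μ σ t (N n) (hM0 n) i
  have hE1 n : ∑ i ∈ Finset.range (N n), |e n i - e n (i + 1)| ≤ 2 * E n := by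
    calc ∑ i ∈ Finset.range (N n), |e n i - e n (i + 1)|
        ≤ ∑ i ∈ Finset.range (N n), (|e n i| + |e n (i + 1)|) :=
          Finset.sum_le_sum fun i _ ↦ abs_sub _ _
      _ = ∑ i ∈ Finset.range (N n), |e n i| + ∑ i ∈ Finset.range (N n), |e n (i + 1)| :=
          Finset.sum_add_distrib
      _ ≤ E n + E n := by
          gcongr
          · exact Finset.sum_le_sum_of_subset_of_nonneg (by simp) fun _ _ _ ↦ abs_nonneg _
          · simp only [E]
            rw [Finset.sum_range_succ']
            exact le_add_of_nonneg_right (abs_nonneg _)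
      _ = 2 * E n := by ring
  refine mul_discount_eq hs hw μ σ t hN hN0 ?_ ?_ h3 h4
  · have hsum n : ∑ i ∈ Finset.range (N n), y (gridPoint t (N n) i) *
        eulerError s w μ σ t (N n) i = ∑ j ∈ Finset.range (N n * M n),
        y (gridPoint t (N n) (j / M n)) * gridDiff s σ t (N n) (M n) j *
        (w (gridPoint t (N n * M n) (j + 1)) - w (gridPoint t (N n * M n) j)) +
        ∑ i ∈ Finset.range (N n), y (gridPoint t (N n) i) * (e n i - e n (i + 1)) := by
      rw [sum_range_mul_eq, ← Finset.sum_add_distrib]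
      refine Finset.sum_congr rfl fun i _ ↦ ?_
      rw [hR, mul_add, Finset.mul_sum]
      congr 1
      refine Finset.sum_congr rfl fun l hl ↦ ?_
      rw [mul_add_div_eq (Finset.mem_range.1 hl), mul_assoc]
    refine Tendsto.congr (fun n ↦ (hsum n).symm) ?_
    rw [← add_zero (0 : ℝ)]
    refine hyB.add (squeeze_zero_norm (a := fun n ↦ C * (2 * E n)) (fun n ↦ ?_) ?_)
    · rw [Real.norm_eq_abs]
      calc |∑ i ∈ Finset.range (N n), y (gridPoint t (N n) i) * (e n i - e n (i + 1))|
          ≤ ∑ i ∈ Finset.range (N n), |y (gridPoint t (N n) i) * (e n i - e n (i + 1))| :=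
            Finset.abs_sum_le_sum_abs _ _
        _ ≤ ∑ i ∈ Finset.range (N n), C * |e n i - e n (i + 1)| := by
            refine Finset.sum_le_sum fun i hi ↦ ?_
            rw [abs_mul]
            gcongr
            exact hC _ (gridPoint_le t (Finset.mem_range.1 hi).le)
        _ ≤ _ := by rw [← Finset.mul_sum]; gcongr; exact hE1 n
    · simpa using (hE.const_mul 2).const_mul C
  · have hlim : Tendsto (fun n ↦ 2 * ∑ i ∈ Finset.range (N n), B n i ^ 2 + 2 * (2 * E n) ^ 2)
        atTop (𝓝 0) := by
      simpa using (hB.const_mul 2).add (((hE.const_mul 2).pow 2).const_mul 2)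
    refine squeeze_zero (fun n ↦ Finset.sum_nonneg fun i _ ↦ sq_nonneg _) (fun n ↦ ?_) hlim
    have hsq : ∑ i ∈ Finset.range (N n), (e n i - e n (i + 1)) ^ 2 ≤ (2 * E n) ^ 2 := by
      calc ∑ i ∈ Finset.range (N n), (e n i - e n (i + 1)) ^ 2
          = ∑ i ∈ Finset.range (N n), |e n i - e n (i + 1)| ^ 2 := by simp_rw [sq_abs]
        _ ≤ (∑ i ∈ Finset.range (N n), |e n i - e n (i + 1)|) ^ 2 :=
            Finset.sum_sq_le_sq_sum_of_nonneg fun i _ ↦ abs_nonneg _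
        _ ≤ _ := by
            have := hE1 n
            have h0 := Finset.sum_nonneg fun i (_ : i ∈ Finset.range (N n)) ↦
              abs_nonneg (e n i - e n (i + 1))
            gcongr
    calc ∑ i ∈ Finset.range (N n), eulerError s w μ σ t (N n) i ^ 2
        ≤ ∑ i ∈ Finset.range (N n), (2 * B n i ^ 2 + 2 * (e n i - e n (i + 1)) ^ 2) := by
          refine Finset.sum_le_sum fun i _ ↦ ?_
          rw [hR]
          nlinarith only [sq_nonneg (B n i - (e n i - e n (i + 1)))]
      _ = 2 * ∑ i ∈ Finset.range (N n), B n i ^ 2 +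
          2 * ∑ i ∈ Finset.range (N n), (e n i - e n (i + 1)) ^ 2 := by
          rw [Finset.sum_add_distrib, Finset.mul_sum, Finset.mul_sum]
      _ ≤ _ := by gcongr

/-- A fine point lies within one coarse mesh of the preceding coarse point, so uniform continuity
applies whatever the refinement `M`. -/
theorem eventually_abs_gridDiff_le {s : ℝ≥0 → ℝ} (hs : Continuous s) (σ : ℝ) (t : ℝ≥0)
    {N M : ℕ → ℕ} (hN : Tendsto N atTop atTop) (hM0 : ∀ n, M n ≠ 0)
    {ε : ℝ} (hε : 0 < ε) :
    ∀ᶠ n in atTop, ∀ j < N n * M n, |gridDiff s σ t (N n) (M n) j| ≤ ε := by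
  filter_upwards [eventually_abs_sub_le hs t hN (ε := ε / (|σ| + 1)) (by positivity)] with n hn j hj
  have hjN : j / M n < N n := Nat.div_lt_of_lt_mul (by rwa [mul_comm])
  have h := hn _ (gridPoint_le t hj.le) _ (gridPoint_le t hjN.le) ?_
  · rw [gridDiff, abs_mul]
    calc |σ| * _ ≤ |σ| * (ε / (|σ| + 1)) := by gcongr
      _ ≤ ε := by
        rw [← mul_div_assoc, div_le_iff₀ (by positivity)]
        nlinarith
  · have h1 : gridPoint t (N n) (j / M n) ≤ gridPoint t (N n * M n) j := by
      rw [← gridPoint_mul t (N n) (j / M n) (hM0 n)]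
      exact gridPoint_mono _ _ (Nat.div_mul_le_self _ _)
    have h2 : gridPoint t (N n * M n) j ≤ gridPoint t (N n) (j / M n + 1) := by
      rw [← gridPoint_mul t (N n) (j / M n + 1) (hM0 n)]
      refine gridPoint_mono _ _ ?_
      have := Nat.lt_div_mul_add (a := j) (Nat.pos_of_ne_zero (hM0 n))
      rw [add_one_mul]; lia
    have h1' : (gridPoint t (N n) (j / M n) : ℝ) ≤ gridPoint t (N n * M n) j := by exact_mod_cast h1
    have h2' : (gridPoint t (N n * M n) j : ℝ) ≤ gridPoint t (N n) (j / M n + 1) := by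
      exact_mod_cast h2
    rw [gridPoint_succ] at h2'
    rw [abs_of_nonneg (by linarith)]
    linarith

/-! ### The explicit solution of the equation. -/

section sde

variable {Ω : Type*} {mΩ : MeasurableSpace Ω} {P : Measure Ω}
  {𝓖 : Filtration ℝ≥0 mΩ} {W S : ℝ≥0 → Ω → ℝ} {μ : Ω → ℝ} {σ s₀ : ℝ}

theorem IsLogNormalPrice.tendstoInMeasure_itoError (hS : IsLogNormalPrice 𝓖 W P μ σ s₀ S)
    (t : ℝ≥0) {N : ℕ} (hN : N ≠ 0) (i : ℕ) :
    TendstoInMeasure P (fun m ω ↦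
      |itoError (fun u ↦ S u ω) (fun u ↦ W u ω) (μ ω) σ t N (m + 1) i|) atTop 0 := by
  obtain ⟨I, hI, hIS⟩ := hS.sde (gridPoint t N i)
  have h := hI (gridSubdivision t N i) (tendsto_mesh_gridSubdivision t hN i)
  have hcongr : I =ᵐ[P] fun ω ↦ S (gridPoint t N i) ω - S 0 ω -
      ∫ u in (0 : ℝ)..gridPoint t N i, μ ω * S u.toNNReal ω := by
    filter_upwards [hIS] with ω hω
    rw [hω]; ring
  have h' := h.congr_right hcongr
  rw [tendstoInMeasure_iff_norm] at h' ⊢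
  intro ε hε
  refine (h' ε hε).congr fun m ↦ ?_
  simp [itoError, itoSum, gridSubdivision]

/-- Here `μ` must be known at time `0`: the weight is then adapted, although the drift is random. -/
theorem measurable_discount (hW : IsWienerProcess 𝓖 W P) (hμ : Measurable[𝓖 0] μ) (u : ℝ≥0) :
    Measurable[𝓖 u] (fun ω ↦ discount (fun u ↦ W u ω) (μ ω) σ u) := by
  have h1 : Measurable[𝓖 u] μ := hμ.mono (𝓖.mono zero_le) le_rfl
  have h2 := hW.adapted u
  unfold discount
  exact Real.measurable_exp.comp (((h1.sub_const _).mul_const _).add (h2.const_mul _)).neg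

/-- The total variance is the constant `t`, so a small constant `δ` suffices; `t + 1` avoids
dividing by zero. -/
theorem exists_dominating_const {G : ℕ → ℕ → Ω → ℝ} {a m : ℕ → ℕ} {v : ℕ → ℝ} {t : ℝ}
    (ht : 0 ≤ t) (hv : ∀ n, a n * m n * v n = t)
    (hG : ∀ ε > 0, ∀ᵐ ω ∂P, ∀ᶠ n in atTop, ∀ k < a n * m n, |G n k ω| ≤ ε) :
    ∀ η > 0, ∃ δ : ℕ → ℝ, (∀ n, 0 ≤ δ n) ∧
      (∀ᵐ ω ∂P, ∀ᶠ n in atTop, ∀ k < a n * m n, |G n k ω| ≤ δ n) ∧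
      ∀ᶠ n in atTop, δ n ^ 2 * (a n * m n * v n) ≤ η := by
  intro η hη
  refine ⟨fun _ ↦ √(η / (t + 1)), fun _ ↦ Real.sqrt_nonneg _, hG _ (by positivity), ?_⟩
  filter_upwards with n
  rw [hv, Real.sq_sqrt (by positivity), div_mul_eq_mul_div, div_le_iff₀ (by positivity)]
  nlinarith

/-- The bound `C` depends on the path, so `δ` is made to grow like `N ^ (1 / 4)`: it eventually
exceeds every `C`, while `δ²` times the total variance is `t² c / √N`. -/
theorem exists_dominating_const_of_bounded {G : ℕ → ℕ → Ω → ℝ} {N : ℕ → ℕ}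
    (hN : Tendsto N atTop atTop) (hN0 : ∀ n, N n ≠ 0) (t c : ℝ)
    (hG : ∀ᵐ ω ∂P, ∃ C, ∀ n, ∀ k < N n, |G n k ω| ≤ C) :
    ∀ η > 0, ∃ δ : ℕ → ℝ, (∀ n, 0 ≤ δ n) ∧
      (∀ᵐ ω ∂P, ∀ᶠ n in atTop, ∀ k < 1 * N n, |G n k ω| ≤ δ n) ∧
      ∀ᶠ n in atTop, δ n ^ 2 * ((1 : ℕ) * N n * ((t / N n) ^ 2 * c)) ≤ η := by
  intro η hη
  have hN' : Tendsto (fun n ↦ √(N n)) atTop atTop :=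
    Real.tendsto_sqrt_atTop.comp (tendsto_natCast_atTop_atTop.comp hN)
  refine ⟨fun n ↦ √(√(N n)), fun _ ↦ Real.sqrt_nonneg _, ?_, ?_⟩
  · filter_upwards [hG] with ω ⟨C, hC⟩
    filter_upwards [(Real.tendsto_sqrt_atTop.comp hN').eventually_ge_atTop C] with n hn k hk
    exact (hC n k (by simpa using hk)).trans hn
  · have hlim : Tendsto (fun n ↦ t ^ 2 * c / √(N n)) atTop (𝓝 0) := hN'.const_div_atTop _
    filter_upwards [hlim.eventually_le_const hη] with n hn
    refine le_trans (le_of_eq ?_) hn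
    have h0 : (0 : ℝ) < N n := by exact_mod_cast Nat.pos_of_ne_zero (hN0 n)
    have h1 : √(N n : ℝ) ≠ 0 := (Real.sqrt_pos.2 h0).ne'
    have h2 : √(N n : ℝ) ^ 2 = N n := Real.sq_sqrt h0.le
    rw [Real.sq_sqrt (Real.sqrt_nonneg _)]
    rw [← h2]
    field_simp
    simp

/-- The log-normal equation has the explicit solution only. -/
theorem IsLogNormalPrice.ae_eq_exp [IsProbabilityMeasure P] (hW : IsWienerProcess 𝓖 W P) (hμ : Measurable[𝓖 0] μ)
    (hS : IsLogNormalPrice 𝓖 W P μ σ s₀ S) (t : ℝ≥0) :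
    ∀ᵐ ω ∂P, S t ω = s₀ * Real.exp ((μ ω - σ ^ 2 / 2) * t + σ * W t ω) := by
  let N (n : ℕ) := n + 1
  have hN0 n : N n ≠ 0 := n.succ_ne_zero
  have hN : Tendsto N atTop atTop := tendsto_add_atTop_nat 1
  -- For each coarse grid, a refinement is chosen that makes the errors at all its points small
  -- together.
  obtain ⟨m, hm⟩ := TendstoInMeasure.exists_diagonal fun n ↦
    TendstoInMeasure.sum_zero (Finset.range (N n + 1)) fun i _ ↦
      hS.tendstoInMeasure_itoError t (hN0 n) i
  let M n := m n + 1
  have hM0 n : M n ≠ 0 := (m n).succ_ne_zero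
  let D n j ω := gridDiff (fun u ↦ S u ω) σ t (N n) (M n) j
  let y u ω := discount (fun u ↦ W u ω) (μ ω) σ u
  have hle n j : gridPoint t (N n) (j / M n) ≤ gridPoint t (N n * M n) j := by
    rw [← gridPoint_mul t (N n) (j / M n) (hM0 n)]
    exact gridPoint_mono _ _ (Nat.div_mul_le_self _ _)
  have hD n j : Measurable[𝓖 (gridPoint t (N n * M n) j)] (D n j) :=
    ((hS.adapted _).sub ((hS.adapted _).mono (𝓖.mono (hle n j)) le_rfl)).const_mul σ
  have hy u : Measurable[𝓖 u] (y u) := measurable_discount hW hμ u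
  have hyD n j : Measurable[𝓖 (gridPoint t (N n * M n) j)]
      (fun ω ↦ y (gridPoint t (N n) (j / M n)) ω * D n j ω) :=
    ((hy _).mono (𝓖.mono (hle n j)) le_rfl).mul (hD n j)
  have hlt {n j} (hj : j < N n * M n) : j / M n < N n :=
    Nat.div_lt_of_lt_mul (by rwa [mul_comm])
  have hv n : (N n : ℝ) * M n * (t / (N n * M n : ℕ)) = t := by
    have h1 : (N n : ℝ) ≠ 0 := by exact_mod_cast hN0 n
    have h2 : (M n : ℝ) ≠ 0 := by exact_mod_cast hM0 n
    push_cast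
    field_simp
  have hB := tendstoInMeasure_sum_sq_blocks
    (fun n ↦ hW.isCenteredNoise_increment t (N n * M n)) hD N M
    (exists_dominating_const t.coe_nonneg hv fun ε hε ↦ by
      filter_upwards [hS.continuous] with ω hω
      exact eventually_abs_gridDiff_le hω σ t hN hM0 hε)
  -- A single block: the square of the whole weighted sum tends to `0`. The same device serves for
  -- `h3` and `h4`.
  have hyB := tendstoInMeasure_sum_sq_blocks
    (fun n ↦ hW.isCenteredNoise_increment t (N n * M n)) hyD (fun _ ↦ 1) (fun n ↦ N n * M n)
    (exists_dominating_const t.coe_nonneg (fun n ↦ by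
      have := hv n
      push_cast at this ⊢
      rw [one_mul, this]) fun ε hε ↦ by
      filter_upwards [hS.continuous, hW.cont] with ω hω hω'
      obtain ⟨C, hC0, hC⟩ := exists_abs_le (continuous_discount hω' (μ ω) σ) t
      filter_upwards [eventually_abs_gridDiff_le hω σ t hN hM0
        (ε := ε / (C + 1)) (by positivity)] with n hn j hj
      rw [one_mul] at hj
      calc |y (gridPoint t (N n) (j / M n)) ω * D n j ω| ≤ C * (ε / (C + 1)) := by
            rw [abs_mul]
            exact mul_le_mul (hC _ (gridPoint_le t (hlt hj).le)) (hn j hj) (abs_nonneg _) hC0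
        _ ≤ ε := by
            rw [← mul_div_assoc, div_le_iff₀ (by positivity)]
            nlinarith)
  have h3 := tendstoInMeasure_sum_sq_blocks
    (fun n ↦ hW.isCenteredNoise_increment_sq t (N n))
    (fun n k ↦ (hS.adapted (gridPoint t (N n) k)).mul (hy (gridPoint t (N n) k)))
    (fun _ ↦ 1) N (exists_dominating_const_of_bounded hN hN0 t _ (by
      filter_upwards [hS.continuous, hW.cont] with ω hω hω'
      obtain ⟨C, hC0, hC⟩ := exists_abs_le (hω.mul (continuous_discount hω' (μ ω) σ)) t
      exact ⟨C, fun n k hk ↦ hC _ (gridPoint_le t hk.le)⟩))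
  have h4 := tendstoInMeasure_sum_sq_blocks
    (fun n ↦ hW.isCenteredNoise_increment_sq t (N n)) (G := fun _ _ _ ↦ 1)
    (fun n k ↦ measurable_const)
    (fun _ ↦ 1) N (exists_dominating_const_of_bounded hN hN0 t _ (.of_forall fun ω ↦
      ⟨1, by simp⟩))
  -- All five quantities are nonnegative, so one almost surely convergent subsequence of their sum
  -- serves each of them.
  obtain ⟨ns, hns, hlim⟩ := (TendstoInMeasure.add_zero_zero (TendstoInMeasure.add_zero_zero
    (TendstoInMeasure.add_zero_zero (TendstoInMeasure.add_zero_zero hm hB) hyB) h3)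
    h4).exists_seq_tendsto_ae
  filter_upwards [hlim, hS.continuous, hW.cont, hS.initial, hW.eval_zero_ae_eq_zero] with
    ω hω hSc hWc hS0 hW0
  have hsplit {a b : ℕ → ℝ} (ha : ∀ n, 0 ≤ a n) (hb : ∀ n, 0 ≤ b n)
      (h : Tendsto (fun n ↦ a n + b n) atTop (𝓝 0)) :
      Tendsto a atTop (𝓝 0) ∧ Tendsto b atTop (𝓝 0) :=
    ⟨squeeze_zero ha (fun n ↦ le_add_of_nonneg_right (hb n)) h,
      squeeze_zero hb (fun n ↦ le_add_of_nonneg_left (ha n)) h⟩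
  have hsq {a : ℕ → ℝ} (h : Tendsto (fun n ↦ a n ^ 2) atTop (𝓝 0)) : Tendsto a atTop (𝓝 0) := by
    have := h.sqrt
    simp only [Real.sqrt_sq_eq_abs, Real.sqrt_zero] at this
    exact tendsto_zero_iff_abs_tendsto_zero _ |>.2 this
  obtain ⟨hω, l4⟩ := hsplit (fun n ↦ by positivity) (fun n ↦ by positivity) hω
  obtain ⟨hω, l3⟩ := hsplit (fun n ↦ by positivity) (fun n ↦ by positivity) hω
  obtain ⟨hω, lyB⟩ := hsplit (fun n ↦ by positivity) (fun n ↦ by positivity) hω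
  obtain ⟨lE, lB⟩ := hsplit (fun n ↦ by positivity) (fun n ↦ by positivity) hω
  simp only [Finset.range_one, Finset.sum_singleton, zero_mul, zero_add, one_mul] at l3 l4 lyB
  have key := mul_discount_eq_of_blocks hSc hWc (μ ω) σ t (N := fun n ↦ N (ns n))
    (M := fun n ↦ M (ns n)) (hN.comp hns.tendsto_atTop) (fun n ↦ hN0 _) (fun n ↦ hM0 _)
    lE lB (hsq lyB) (hsq l3) (hsq l4)
  rw [hS0] at key
  simp only [discount, hW0, NNReal.coe_zero, mul_zero, add_zero, neg_zero, Real.exp_zero,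
    mul_one] at key
  rw [← key, mul_assoc, ← Real.exp_add, neg_add_cancel, Real.exp_zero, mul_one]

end sde

/-! ### Conditional laws and Gaussian independence. -/

/-- If `D` is normally distributed and independent of `m`, and `Z` is `m`-measurable, then `D + Z`
is conditionally normal given `m`. -/
theorem isCondNormal_add_of_indep {Ω : Type*} {m mΩ : MeasurableSpace Ω} {P : Measure Ω}
    [IsProbabilityMeasure P] (hm : m ≤ mΩ) {D Z X : Ω → ℝ} {b : ℝ}
    {v : ℝ≥0} (hD : HasLaw D (gaussianReal b v) P)
    (hind : Indep (MeasurableSpace.comap D inferInstance) m P) (hZ : Measurable[m] Z)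
    (hXm : Measurable X) (hX : ∀ᵐ ω ∂P, X ω = D ω + Z ω) :
    IsCondNormal m P X (fun ω ↦ b + Z ω) v := by
  intro B hB
  have hXB : MeasurableSet (X ⁻¹' B) := hXm hB
  have hker : Measurable[m] fun ω ↦ gaussianReal (b + Z ω) v B := by
    have h1 : Measurable[m] fun ω ↦ (b + Z ω, v) := (hZ.const_add b).prodMk measurable_const
    exact (Measure.measurable_coe hB).comp (measurable_gaussianReal.comp h1)
  have hg : Measurable[m] fun ω ↦ (gaussianReal (b + Z ω) v).real B := hker.ennreal_toReal
  have hgi : Integrable (fun ω ↦ (gaussianReal (b + Z ω) v).real B) P :=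
    Integrable.of_bound (hg.mono hm le_rfl).aestronglyMeasurable 1
      (ae_of_all _ fun ω ↦ by
        rw [Real.norm_eq_abs, abs_of_nonneg measureReal_nonneg]
        exact measureReal_le_one)
  symm
  refine ae_eq_condExp_of_forall_setIntegral_eq hm ((integrable_const _).indicator hXB)
    (fun _ _ _ ↦ hgi.integrableOn) (fun A hA _ ↦ ?_) hg.aestronglyMeasurable
  have hA' : MeasurableSet A := hm A hA
  -- Recording `A` by its indicator makes `A ∩ X ⁻¹' B` an event about the independent pair `(D,
  -- Y)`, up to a null set; Fubini then integrates out `D`.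
  let Y : Ω → ℝ × ℝ := fun ω ↦ (Z ω, A.indicator 1 ω)
  have hone : Measurable[m] (1 : Ω → ℝ) := measurable_const
  have hYm : Measurable[m] Y := hZ.prodMk (hone.indicator hA)
  have hY' : Measurable Y := hYm.mono hm le_rfl
  have hDY : IndepFun D Y P := by
    rw [IndepFun_iff_Indep]
    exact indep_of_indep_of_le_right hind hYm.comap_le
  let E : Set (ℝ × ℝ × ℝ) := {q | q.2.2 = 1 ∧ q.1 + q.2.1 ∈ B}
  have hE : MeasurableSet E := by
    refine MeasurableSet.inter ?_ ?_
    · exact measurableSet_eq_fun (by fun_prop) measurable_const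
    · exact (by fun_prop : Measurable fun q : ℝ × ℝ × ℝ ↦ q.1 + q.2.1) hB
  have hjoint : P (A ∩ X ⁻¹' B) = ∫⁻ ω in A, gaussianReal (b + Z ω) v B ∂P := by
    calc P (A ∩ X ⁻¹' B) = P ((fun ω ↦ (D ω, Y ω)) ⁻¹' E) := by
          refine measure_congr ?_
          filter_upwards [hX] with ω hω
          refine propext ?_
          change (ω ∈ A ∧ X ω ∈ B) ↔ (A.indicator (1 : Ω → ℝ) ω = 1 ∧ D ω + Z ω ∈ B)
          rw [hω]
          by_cases hωA : ω ∈ A <;> simp [hωA]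
      _ = P.map (fun ω ↦ (D ω, Y ω)) E :=
          (Measure.map_apply_of_aemeasurable (hD.aemeasurable.prodMk hY'.aemeasurable) hE).symm
      _ = ((gaussianReal b v).prod (P.map Y)) E := by
          rw [hDY.map_prod_eq_prod_map_map hD.aemeasurable hY'.aemeasurable, hD.map_eq]
      _ = ∫⁻ y, gaussianReal b v ((fun x ↦ (x, y)) ⁻¹' E) ∂(P.map Y) :=
          Measure.prod_apply_symm hE
      _ = ∫⁻ ω, gaussianReal b v ((fun x ↦ (x, Y ω)) ⁻¹' E) ∂P :=
          lintegral_map (measurable_measure_prodMk_right hE) hY'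
      _ = ∫⁻ ω, A.indicator (fun ω ↦ gaussianReal (b + Z ω) v B) ω ∂P := by
          congr 1 with ω
          by_cases hωA : ω ∈ A
          · rw [Set.indicator_of_mem hωA, ← gaussianReal_map_add_const,
              Measure.map_apply (by fun_prop) hB]
            congr 1 with x
            simp [E, Y, hωA]
          · rw [Set.indicator_of_notMem hωA]
            convert measure_empty (μ := gaussianReal b v)
            ext x
            simp [E, Y, hωA]
      _ = _ := lintegral_indicator hA' _
  rw [integral_indicator_const _ hXB, smul_eq_mul, mul_one, measureReal_def,
    Measure.restrict_apply hXB, Set.inter_comm, hjoint]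
  simp_rw [measureReal_def]
  exact integral_toReal (hker.mono hm le_rfl).aemeasurable
    (ae_of_all _ fun ω ↦ measure_lt_top _ _)

section filtering

variable {Ω : Type*} {mΩ : MeasurableSpace Ω} {P : Measure Ω}

/-- An independent Gaussian variable can be adjoined to a Gaussian process. -/
theorem isGaussianProcess_sumElim [IsProbabilityMeasure P] {T : Type*} {X : Ω → ℝ} {W : T → Ω → ℝ}
    (hX : HasGaussianLaw X P) (hW : IsGaussianProcess W P)
    (hind : IndepFun X (fun ω t ↦ W t ω) P) :
    IsGaussianProcess (Sum.elim (fun _ : Unit ↦ X) W) P where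
  hasGaussianLaw I := by
    classical
    let J : Finset T := I.toRight
    have hJ : IndepFun X (fun ω ↦ J.restrict (W · ω)) P :=
      hind.comp (φ := id) measurable_id (Finset.measurable_restrict J)
    have h := IndepFun.hasGaussianLaw hX (hW.hasGaussianLaw J) hJ
    let L : (ℝ × (J → ℝ)) →ₗ[ℝ] I → ℝ :=
      { toFun x i := match i with
          | ⟨.inl _, _⟩ => x.1
          | ⟨.inr s, hs⟩ => x.2 ⟨s, by simpa [J] using hs⟩
        map_add' x y := by ext ⟨_ | _, _⟩ <;> simp
        map_smul' c x := by ext ⟨_ | _, _⟩ <;> simp }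
    convert! h.map L.toContinuousLinearMap
    ext ⟨_ | _, _⟩ <;> rfl

/-- For `s ≤ t` the covariance with `s μ + σ W s` is `s (a v + b σ)`, because `min s t = s`. The
single condition `hab` therefore kills it for all `s` at once, and joint Gaussianity upgrades this
to independence of the whole past. -/
theorem indepFun_linear_drift [IsProbabilityMeasure P] {μ : Ω → ℝ} {W : ℝ≥0 → Ω → ℝ} {σ β₀ : ℝ} {v : ℝ≥0}
    (hprior : HasLaw μ (gaussianReal β₀ v) P) (hW : IsPreBrownianReal W P)
    (hind : IndepFun μ (fun ω t ↦ W t ω) P) (t : ℝ≥0) {a b : ℝ}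
    (hab : a * v + b * σ = 0) :
    IndepFun (fun ω ↦ a * μ ω + b * W t ω)
      (fun ω (s : Set.Iic t) ↦ s.1 * μ ω + σ * W s ω) P := by
  have hμm := hprior.aemeasurable
  have hWm s := hW.aemeasurable s
  have hμ2 : MemLp μ 2 P := hprior.hasGaussianLaw.memLp_two
  have hW2 s : MemLp (W s) 2 P := (hW.isGaussianProcess.hasGaussianLaw_eval s).memLp_two
  have hGP := isGaussianProcess_sumElim hprior.hasGaussianLaw hW.isGaussianProcess hind
  have hpair : IndepFun (fun ω (_ : Unit) ↦ a * μ ω + b * W t ω)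
      (fun ω (s : Set.Iic t) ↦ s.1 * μ ω + σ * W s ω) P := by
    apply IsGaussianProcess.indepFun_of_covariance_eq_zero
      (X := fun (_ : Unit) ω ↦ a * μ ω + b * W t ω)
      (Y := fun (s : Set.Iic t) ω ↦ s.1 * μ ω + σ * W s ω)
    · have hlin (c d : ℝ) (s : ℝ≥0) : ∃ I : Finset (Unit ⊕ ℝ≥0), ∃ L : (I → ℝ) →L[ℝ] ℝ,
          ∀ ω, c * μ ω + d * W s ω =
            L (I.restrict (Sum.elim (fun _ : Unit ↦ μ) W · ω)) := by
        classical
        refine ⟨{.inl (), .inr s}, c • .proj ⟨.inl (), by simp⟩ + d • .proj ⟨.inr s, by simp⟩,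
          fun ω ↦ by simp⟩
      refine hGP.of_isGaussianProcess ?_
      rintro (_ | s)
      · exact hlin a b t
      · exact hlin s.1 σ s.1
    · intro _; fun_prop
    · intro s; fun_prop
    · rintro _ ⟨s, hs⟩
      have hμW r : cov[μ, W r; P] = 0 :=
        IndepFun.covariance_eq_zero (hind.comp measurable_id (measurable_pi_apply r)) hμ2 (hW2 r)
      have hμμ : cov[μ, μ; P] = v := by
        rw [covariance_self hμm, hprior.variance_eq, variance_id_gaussianReal]
      have e1 : (fun ω ↦ a * μ ω + b * W t ω) = a • μ + b • W t := rfl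
      have e2 : (fun ω ↦ (s : ℝ) * μ ω + σ * W s ω) = (s : ℝ) • μ + σ • W s := rfl
      change cov[fun ω ↦ a * μ ω + b * W t ω, fun ω ↦ (s : ℝ) * μ ω + σ * W s ω; P] = 0
      rw [e1, e2, covariance_add_left (hμ2.const_smul a) ((hW2 t).const_smul b)
        ((hμ2.const_smul _).add ((hW2 s).const_smul _)),
        covariance_add_right (hμ2.const_smul a) (hμ2.const_smul _) ((hW2 s).const_smul _),
        covariance_add_right ((hW2 t).const_smul b) (hμ2.const_smul _) ((hW2 s).const_smul _)]
      simp only [covariance_smul_left, covariance_smul_right, hμμ, hμW, covariance_comm (W t) μ,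
        hW.covariance_eval, min_eq_right (show s ≤ t from hs)]
      linear_combination (s : ℝ) * hab
  exact hpair.comp (measurable_pi_apply ()) measurable_id

theorem hasLaw_linear_drift {μ : Ω → ℝ} {W : ℝ≥0 → Ω → ℝ} {β₀ : ℝ} {v w : ℝ≥0}
    (hprior : HasLaw μ (gaussianReal β₀ v) P) (hW : IsPreBrownianReal W P)
    (hind : IndepFun μ (fun ω t ↦ W t ω) P) (t : ℝ≥0) {a b : ℝ}
    (hw : (w : ℝ) = a ^ 2 * v + b ^ 2 * t) :
    HasLaw (fun ω ↦ a * μ ω + b * W t ω) (gaussianReal (a * β₀) w) P := by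
  have h1 := gaussianReal_const_mul hprior a
  have h2 := gaussianReal_const_mul (hW.hasLaw_eval t) b
  have hi : IndepFun (fun ω ↦ a * μ ω) (fun ω ↦ b * W t ω) P :=
    hind.comp (φ := fun x ↦ a * x) (ψ := fun f : ℝ≥0 → ℝ ↦ b * f t) (by fun_prop) (by fun_prop)
  refine ⟨h1.aemeasurable.add h2.aemeasurable, ?_⟩
  have h := gaussianReal_add_gaussianReal_of_indepFun hi h1.map_eq h2.map_eq
  have e : w = .mk (a ^ 2) (sq_nonneg _) * v + .mk (b ^ 2) (sq_nonneg _) * t := NNReal.eq hw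
  rw [mul_zero, add_zero, ← e] at h
  exact h

end filtering

/-! ### The posterior law of the drift. -/

theorem mainTheorem5 {Ω : Type*} [mΩ : MeasurableSpace Ω] (P : Measure Ω) [IsProbabilityMeasure P]
    (𝓕 : Filtration ℝ≥0 mΩ) (W : ℝ≥0 → Ω → ℝ) (μ : Ω → ℝ) (S : ℝ≥0 → Ω → ℝ)
    (σ s₀ β₀ ν₀ : ℝ) (hσ : 0 < σ) (hs₀ : 0 < s₀) (hν₀ : 0 < ν₀ ^ 2)
    (hμ : Measurable μ)
    (hprior : HasLaw μ (gaussianReal β₀ (ν₀ ^ 2).toNNReal) P)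
    (hindep : IndepFun μ (fun ω t ↦ W t ω) P)
    (hW : IsWienerProcess (initialEnlargement 𝓕 μ hμ) W P)
    (hS : IsLogNormalPrice (initialEnlargement 𝓕 μ hμ) W P μ σ s₀ S)
    (t : ℝ≥0) :
    IsCondNormal (Filtration.natural S hS.stronglyMeasurable t) P μ
      (fun ω ↦ posteriorMean σ β₀ ν₀ t (μ ω * t + σ * W t ω))
      (posteriorVariance σ ν₀ t).toNNReal ∧
    (∀ᵐ ω ∂P, posteriorMean σ β₀ ν₀ t (μ ω * t + σ * W t ω) =
      posteriorMean σ β₀ ν₀ t (Real.log (S t ω / S 0 ω) + 1 / 2 * σ ^ 2 * t)) ∧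
    Measurable[Filtration.natural S hS.stronglyMeasurable t] (fun ω ↦
      posteriorMean σ β₀ ν₀ t (Real.log (S t ω / S 0 ω) + 1 / 2 * σ ^ 2 * t)) := by
  have hμ0 : Measurable[initialEnlargement 𝓕 μ hμ 0] μ :=
    measurable_iff_comap_le.2 (le_sup_right (a := 𝓕 0))
  have hsol := hS.ae_eq_exp hW hμ0
  set m := Filtration.natural S hS.stronglyMeasurable t with hm
  have hmcomap : m = .comap (fun ω (j : Set.Iic t) ↦ S j ω) inferInstance :=
    Filtration.natural_eq_comap _ _ _
  have hSm {s} (hs : s ≤ t) : Measurable[m] (S s) := by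
    rw [hmcomap]
    exact (measurable_pi_apply (⟨s, hs⟩ : Set.Iic t)).comp
      (comap_measurable (fun ω (j : Set.Iic t) ↦ S j ω))
  -- The σ-algebra `m` is not completed, so the observable must be written through `S` itself; it
  -- agrees with `μ t + σ W t` only almost surely.
  let Y ω := Real.log (S t ω / S 0 ω) + 1 / 2 * σ ^ 2 * t
  have hYm : Measurable[m] Y :=
    (((hSm le_rfl).div (hSm zero_le)).log).add_const _
  have hY : ∀ᵐ ω ∂P, μ ω * t + σ * W t ω = Y ω := by
    filter_upwards [hsol t, hS.initial] with ω h1 h2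
    simp only [Y]
    rw [h1, h2, mul_div_cancel_left₀ _ hs₀.ne', Real.log_exp]
    ring
  have hmean : ∀ᵐ ω ∂P, posteriorMean σ β₀ ν₀ t (μ ω * t + σ * W t ω) =
      posteriorMean σ β₀ ν₀ t (Y ω) := by
    filter_upwards [hY] with ω h
    rw [h]
  refine ⟨?_, hmean, (hYm.const_mul _).const_add _⟩
  set q := σ ^ 2 + ν₀ ^ 2 * t with hq
  have hq0 : 0 < q := by positivity
  have hv : ((ν₀ ^ 2).toNNReal : ℝ) = ν₀ ^ 2 := Real.coe_toNNReal _ hν₀.le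
  -- These are the coefficients of `μ - (ν₀² / q) (μ t + σ W t)`, since `1 - ν₀² t / q = σ² / q`.
  have hD : IndepFun (fun ω ↦ σ ^ 2 / q * μ ω + -(ν₀ ^ 2 / q * σ) * W t ω)
      (fun ω (s : Set.Iic t) ↦ S s ω) P := by
    have h := indepFun_linear_drift hprior hW.toIsPreBrownianReal hindep t
      (σ := σ) (a := σ ^ 2 / q) (b := -(ν₀ ^ 2 / q * σ)) (by rw [hv]; ring)
    have h' := h.comp (φ := id) (ψ := fun x (s : Set.Iic t) ↦
      s₀ * Real.exp (x s - σ ^ 2 / 2 * s.1)) measurable_id (by fun_prop)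
    -- Almost sure equality at each fixed time suffices, although there are uncountably many times.
    refine IndepFun.process_congr_right (X := fun (s : Set.Iic t) ω ↦
      s₀ * Real.exp ((s.1 * μ ω + σ * W s ω) - σ ^ 2 / 2 * s.1)) h' fun s ↦ ?_
    filter_upwards [hsol s] with ω hω
    rw [hω]
    congr 2
    ring
  have hind : Indep (MeasurableSpace.comap
      (fun ω ↦ σ ^ 2 / q * μ ω + -(ν₀ ^ 2 / q * σ) * W t ω) inferInstance) m P := by
    rw [hmcomap]
    exact (IndepFun_iff_Indep _ _ _).1 hD
  -- The variance is `σ⁴ ν₀² / q² + ν₀⁴ σ² t / q² = σ² ν₀² / q`.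
  have hlaw := hasLaw_linear_drift (w := (posteriorVariance σ ν₀ t).toNNReal) hprior
    hW.toIsPreBrownianReal hindep t (a := σ ^ 2 / q) (b := -(ν₀ ^ 2 / q * σ)) (by
      rw [hv, posteriorVariance, Real.coe_toNNReal _ (by positivity), ← hq]
      field_simp
      rw [hq])
  have hcond := isCondNormal_add_of_indep (X := μ) (Filtration.le _ t) hlaw hind
    (hYm.const_mul (ν₀ ^ 2 / q)) hμ (by
      filter_upwards [hY] with ω hω
      rw [← hω]
      field_simp
      rw [hq]
      ring)
  intro B hB
  filter_upwards [hcond B hB, hmean] with ω h1 h2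
  rw [h1, h2]
  rfl
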